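/- For $\delta>0$ let $\gamma_\delta=\lceil(1/\delta)^{1/\delta}\rceil$. **Model.** The common ground set of two matroids arrives element by element as a stream (in the weighted problem each element arrives with its weight), in an arbitrary order that is the same in every pass. The memory, initially blank, is a list of cells; a cell holds either one element that has been read from the stream (with its weight, if any) or one auxiliary word (a natural number). Independence oracles for both matroids may be queried on sets of elements currently stored or just being read. After every element the memory is updated by an arbitrary rule; after $p$ passes a common independent set consisting of stored elements is output. Space is the maximum number of memory cells in use between updates; the word range is a strict upper bound for the auxiliary words. A randomized algorithm is a random deterministic one; it is $\alpha$-approximate if its output is always a common independent set, whose expected size (in the weighted problem: weight) is at least $\alpha$ times the maximum. For deterministic algorithms this is the usual worst-case guarantee. **Theorem.** There are absolute constants $c\ge 1$ and $C>0$ such that the following holds for all $\varepsilon>0$, $0<\alpha\le 1$ and $p\in\mathbb N$. Let $S_u(n,r_1,r_2,r)$ and $b_u(n)\in\mathbb N$ be nondecreasing in each argument. Let $\mathcal A_u$ be a $p$-pass streaming algorithm that is $\alpha$-approximate for maximum cardinality matroid intersection and that, on every pair of matroids of ranks $r_1,r_2$ on $n$ elements whose largest common independent set has size $r$, uses space at most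 $S_u(n,r_1,r_2,r)$ and word range at most $b_u(n)$. Then there is a $p$-pass streaming algorithm $\mathcal A_w$ that is $\alpha(1-\varepsilon)$-approximate for maximum weight matroid intersection with arbitrary positive real weights and that, on every pair of matroids with parameters $n,r_1,r_2,r$ and with ratio $W$ of the largest to the smallest weight, uses space at most $$C\cdot\frac{S_u(\gamma n,\gamma r_1,\gamma r_2,\gamma r)\,(1+\log W)}{\varepsilon},\qquad \gamma=\gamma_{\varepsilon/c}=\varepsilon^{-O(1/\varepsilon)}\ \text{ as }\varepsilon\to0,$$ and word range at most $C(\gamma+b_u(\gamma n))$, that is, word length larger than that of $\mathcal A_u$ on $\gamma n$ elements by at most an additive $O(1+\log\gamma)$. (On an empty ground set $\log W$ is read as $0$.) If $\mathcal A_u$ is deterministic, then so is $\mathcal A_w$. -/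

import Mathlib

open MeasureTheory

noncomputable section

/-- The blow-up factor `γ_ε = ⌈(1/ε)^(1/ε)⌉`. -/
def gammaEps (ε : ℝ) : ℕ := ⌈(1 / ε) ^ (1 / ε)⌉₊

/-- A matroid intersection instance presented as a stream. Elements are named by natural numbers,
the common ground set is exactly the (duplicate-free) list `order`, and each element carries a datum
in `D`: nothing for the unweighted problem (`D = Unit`), its weight for the weighted one (`D = ℝ`). -/
structure MatroidStream (D : Type) where
  order : List ℕ
  nodup : order.Nodup
  M₁ : Matroid ℕ
  M₂ : Matroid ℕ
  ground₁ : M₁.E = {e | e ∈ order}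
  ground₂ : M₂.E = {e | e ∈ order}
  data : ℕ → D

namespace MatroidStream

variable {D : Type}

/-- `X` is independent in both matroids. -/
def CommonIndep (I : MatroidStream D) (X : Finset ℕ) : Prop :=
  I.M₁.Indep (X : Set ℕ) ∧ I.M₂.Indep (X : Set ℕ)

/-- The size `n` of the ground set. -/
def size (I : MatroidStream D) : ℕ := I.order.length

/-- The maximum cardinality `r` of a common independent set. -/
def commonRank (I : MatroidStream D) : ℕ :=
  sSup {k | ∃ X : Finset ℕ, I.CommonIndep X ∧ X.card = k}

/-- The parameters `(n, r₁, r₂, r)` of an instance. -/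
def params (I : MatroidStream D) : ℕ × ℕ × ℕ × ℕ :=
  (I.size, I.M₁.eRank.toNat, I.M₂.eRank.toNat, I.commonRank)

/-- All weights are positive. -/
def PositiveWeights (I : MatroidStream ℝ) : Prop := ∀ e ∈ I.order, 0 < I.data e

/-- The weight of a set of elements. -/
def weight (I : MatroidStream ℝ) (X : Finset ℕ) : ℝ := ∑ e ∈ X, I.data e

/-- The weight ratio `W`: the maximum weight divided by the minimum weight. -/
def weightRatio (I : MatroidStream ℝ) : ℝ :=
  sSup (I.data '' {e | e ∈ I.order}) / sInf (I.data '' {e | e ∈ I.order})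

end MatroidStream

/-- A memory cell: either a stored stream element (its name and datum), or an auxiliary
machine word, which is a natural number. -/
inductive Cell (D : Type) where
  | elem (e : ℕ) (d : D)
  | word (k : ℕ)

/-- The names of the elements that are stored in a memory. -/
def storedElems {D : Type} (m : List (Cell D)) : Set ℕ := {e | ∃ d, Cell.elem e d ∈ m}

/-- An independence oracle: it answers queries about finite sets of elements. -/
abbrev IndepOracle : Type := Finset ℕ → Prop

/-- The independence oracle of `M`, usable only for sets of currently available elements (on every
other query it answers `False`). -/
def localOracle (M : Matroid ℕ) (avail : Set ℕ) : IndepOracle :=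
  fun X => (X : Set ℕ) ⊆ avail ∧ M.Indep (X : Set ℕ)

/-- A deterministic streaming algorithm. `step j o₁ o₂ m (e, d)` is the memory after the element `e`
with datum `d` has been read in pass `j` with memory `m`; `output` is computed from the final memory.
The update and output rules are arbitrary functions of the memory, of the element being read and of
the answers `o₁`, `o₂` of the two oracles, but an element can only enter the memory, or be output, by
being read, respectively by being stored. -/
structure StreamAlg (D : Type) where
  step : ℕ → IndepOracle → IndepOracle → List (Cell D) → ℕ × D → List (Cell D)
  output : IndepOracle → IndepOracle → List (Cell D) → Finset ℕ
  step_elem : ∀ j o₁ o₂ m x e d, Cell.elem e d ∈ step j o₁ o₂ m x →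
    Cell.elem e d ∈ m ∨ (e, d) = x
  output_elem : ∀ o₁ o₂ m, ∀ e ∈ output o₁ o₂ m, e ∈ storedElems m

namespace StreamAlg

variable {D : Type}

/-- Reading the element `e` of the instance `I` in pass `j`; the oracles can be asked only about
sets of stored elements and `e`. -/
def readElem (A : StreamAlg D) (I : MatroidStream D) (j : ℕ) (m : List (Cell D)) (e : ℕ) :
    List (Cell D) :=
  A.step j (localOracle I.M₁ (insert e (storedElems m)))
    (localOracle I.M₂ (insert e (storedElems m))) m (e, I.data e)

/-- The memory at the start of pass `j` (passes are numbered from `0`): blank at first, and carried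
over from one pass to the next. Every pass reads the whole stream in the same order. -/
def startMem (A : StreamAlg D) (I : MatroidStream D) : ℕ → List (Cell D)
  | 0 => []
  | j + 1 => I.order.foldl (A.readElem I j) (A.startMem I j)

/-- The memory in pass `j` after `k` elements of the stream have been read in that pass. -/
def memAt (A : StreamAlg D) (I : MatroidStream D) (j k : ℕ) : List (Cell D) :=
  (I.order.take k).foldl (A.readElem I j) (A.startMem I j)

/-- The output after `p` passes. -/
def result (A : StreamAlg D) (I : MatroidStream D) (p : ℕ) : Finset ℕ :=
  A.output (localOracle I.M₁ (storedElems (A.startMem I p)))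
    (localOracle I.M₂ (storedElems (A.startMem I p))) (A.startMem I p)

/-- During its `p` passes over `I` the algorithm never uses more than `s` memory cells. -/
def SpaceAtMost (A : StreamAlg D) (I : MatroidStream D) (p : ℕ) (s : ℝ) : Prop :=
  ∀ j < p, ∀ k ≤ I.size, ((A.memAt I j k).length : ℝ) ≤ s

/-- During its `p` passes over `I` all auxiliary words of the algorithm are less than `b`. -/
def WordsBelow (A : StreamAlg D) (I : MatroidStream D) (p : ℕ) (b : ℝ) : Prop :=
  ∀ j < p, ∀ k ≤ I.size, ∀ v : ℕ, Cell.word v ∈ A.memAt I j k → (v : ℝ) < b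

end StreamAlg

/-- A randomized streaming algorithm is a random deterministic one, `A ω` with `ω` drawn from the
probability space `(Ω, P)`. After `p` passes over `I` it is an `α`-approximation for the objective
`val`: the output is a random variable, is always a common independent set, and its expected value is
at least `α` times the value of every common independent set. For constant `A` this is the usual
worst-case guarantee of a deterministic algorithm. -/
def IsApproxOn {D Ω : Type} [MeasurableSpace Ω] (P : Measure Ω) (A : Ω → StreamAlg D) (p : ℕ)
    (α : ℝ) (I : MatroidStream D) (val : Finset ℕ → ℝ) : Prop :=
  (∀ X : Finset ℕ, MeasurableSet {ω | (A ω).result I p = X}) ∧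
  (∀ ω, I.CommonIndep ((A ω).result I p)) ∧
  ∀ J : Finset ℕ, I.CommonIndep J → α * val J ≤ ∫ ω, val ((A ω).result I p) ∂P

/-- An `α`-approximate `p`-pass algorithm for maximum cardinality matroid intersection. -/
def IsUnweightedApprox {Ω : Type} [MeasurableSpace Ω] (P : Measure Ω) (A : Ω → StreamAlg Unit)
    (p : ℕ) (α : ℝ) : Prop :=
  ∀ I : MatroidStream Unit, IsApproxOn P A p α I (fun X => (X.card : ℝ))

/-- An `α`-approximate `p`-pass algorithm for maximum weight matroid intersection with positive
real weights. -/
def IsWeightedApprox {Ω : Type} [MeasurableSpace Ω] (P : Measure Ω) (A : Ω → StreamAlg ℝ)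
    (p : ℕ) (α : ℝ) : Prop :=
  ∀ I : MatroidStream ℝ, I.PositiveWeights → IsApproxOn P A p α I I.weight

/-- The parameter tuple `(γ n, γ r₁, γ r₂, γ r)`. -/
def scaleParams (γ : ℕ) (q : ℕ × ℕ × ℕ × ℕ) : ℕ × ℕ × ℕ × ℕ :=
  (γ * q.1, γ * q.2.1, γ * q.2.2.1, γ * q.2.2.2)

end

/-! Weights become multiplicities. Suppose first that the weights are integers `μ e ≤ γ`. Replace
`e` by `μ e` copies and each matroid by a direct sum of copies of itself, called layers. The `i`-th
copy of `e` goes to layer `i` of the first matroid and to layer `μ e - 1 - i` of the second. All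
copies of a common independent set `J` form a common independent set of size `μ(J)`. Conversely, let
`F` be common independent in the unfolded instance. Weight splitting (`exists_weight_splitting`) on
the projection of `F` yields a common independent `J` and functions with `μ ≤ v₁ + v₂` such that the
maximum `v₁`-weight in the first matroid plus the maximum `v₂`-weight in the second is at most
`μ(J)`. A copy whose first layer is not below `v₁ e` has its second layer below `v₂ e`; counting
layer by layer gives `|F| ≤ μ(J)` (`exists_refold`). Hence approximation factors carry over without
loss.

Arbitrary weights are cut into windows. For a base `q` of order `1/ε`, window `a` holds the weights
whose integer base-`q` logarithm lies strictly between `a` and `a + q`. Rounding down to multiples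
of `q ^ a` costs a factor `1 - 1/q`, and multiplicities are at most `q ^ q ≤ γ`. The windows of one
residue class modulo `q` are disjoint and miss only one logarithm in `q`, so by averaging some class
keeps a fraction `1 - 1/q` of the optimum (`exists_residue`). The missing logarithm separates
consecutive windows by a factor `q`, so merging their solutions from heavy to light costs only a
factor `1 + 4/q` (`exists_merge`). The good class need not be known: the output is the best common
independent set in the union of all window solutions.

All window runs are simulated in parallel (`windowAlg`). A run changes only when an element of its
window is read, so each of its cells can be stored along with an element of that window; the weight
of this element and a shift below `q` identify the window. A simulated cell thus takes three cells,
words do not grow with the weights, and at most `log W + q` windows are in use.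

Weight splitting itself comes from Edmonds' min-max theorem (`exists_common_indep`), applied to the
matroids of maximum-weight bases in order to decrease a duality gap. -/

noncomputable section

/-! ### Rank functions and Edmonds' matroid intersection theorem. -/

section RankFunctions

open Finset

variable {α : Type*} [DecidableEq α]

/-- The rank function axioms of a matroid, for a function on finite sets. -/
structure IsRankFun (r : Finset α → ℕ) : Prop where
  empty : r ∅ = 0
  mono : ∀ ⦃X Y⦄, X ⊆ Y → r X ≤ r Y
  insert_le : ∀ e X, r (insert e X) ≤ r X + 1
  submod : ∀ X Y, r (X ∩ Y) + r (X ∪ Y) ≤ r X + r Y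

namespace IsRankFun

variable {r r₁ r₂ : Finset α → ℕ}

theorem le_card (h : IsRankFun r) (X : Finset α) : r X ≤ #X := by
  induction X using Finset.induction_on with
  | empty => simp [h.empty]
  | insert e X he ih =>
    rw [card_insert_of_notMem he]
    have := h.insert_le e X
    omega

theorem union_le_add_card (h : IsRankFun r) (X Y : Finset α) : r (X ∪ Y) ≤ r X + #Y := by
  have := h.submod X Y
  have := h.le_card Y
  omega

theorem insert_le_add (h : IsRankFun r) (e : α) (X : Finset α) :
    r (insert e X) ≤ r X + r {e} := by
  have := h.submod {e} X
  rw [← insert_eq] at this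
  omega

theorem contract (h : IsRankFun r) {e : α} (he : r {e} = 1) :
    IsRankFun (fun X => r (insert e X) - 1) where
  empty := by simp [he]
  mono X Y hXY := Nat.sub_le_sub_right (h.mono (insert_subset_insert _ hXY)) 1
  insert_le f X := by
    have := h.insert_le f (insert e X)
    rw [insert_comm] at this
    omega
  submod X Y := by
    have h1 := h.submod (insert e X) (insert e Y)
    rw [← insert_inter_distrib, ← insert_union_distrib] at h1
    have h2 : ∀ Z, 1 ≤ r (insert e Z) := fun Z => he ▸ h.mono (by simp)
    have := h2 X
    have := h2 Y
    have := h2 (X ∩ Y)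
    have := h2 (X ∪ Y)
    omega

/-- Edmonds' matroid intersection theorem for rank functions. -/
theorem exists_common_indep (G : Finset α) : ∀ {r₁ r₂ : Finset α → ℕ}, IsRankFun r₁ →
    IsRankFun r₂ → ∃ I ⊆ G, r₁ I = #I ∧ r₂ I = #I ∧ ∃ A ⊆ G, r₁ A + r₂ (G \ A) ≤ #I := by
  induction G using Finset.induction_on with
  | empty =>
    intro r₁ r₂ h₁ h₂
    exact ⟨∅, by simp, by simp [h₁.empty], by simp [h₂.empty], ∅, by simp,
      by simp [h₁.empty, h₂.empty]⟩
  | insert e G he ih =>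
    intro r₁ r₂ h₁ h₂
    obtain ⟨I, hIG, hI1, hI2, A, hAG, hA⟩ := ih h₁ h₂
    have heA : e ∉ A := fun h => he (hAG h)
    have hs : (insert e G) \ A = insert e (G \ A) := by
      rw [insert_sdiff_of_notMem _ heA]
    -- A loop of the first matroid is put into `A`, a loop of the second into the complement;
    -- neither affects the bound.
    by_cases hl1 : r₁ {e} = 0
    · refine ⟨I, hIG.trans (subset_insert _ _), hI1, hI2, insert e A,
        insert_subset_insert _ hAG, ?_⟩
      have := h₁.insert_le_add e A
      rw [insert_sdiff_insert, sdiff_insert_of_notMem he]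
      omega
    by_cases hl2 : r₂ {e} = 0
    · refine ⟨I, hIG.trans (subset_insert _ _), hI1, hI2, A,
        hAG.trans (subset_insert _ _), ?_⟩
      have := h₂.insert_le_add e (G \ A)
      rw [hs]
      omega
    have hr1 : r₁ {e} = 1 := by have := h₁.le_card {e}; simp at this; omega
    have hr2 : r₂ {e} = 1 := by have := h₂.le_card {e}; simp at this; omega
    obtain ⟨J, hJG, hJ1, hJ2, B, hBG, hB⟩ := ih (h₁.contract hr1) (h₂.contract hr2)
    have heJ : e ∉ J := fun h => he (hJG h)
    have p1 : ∀ Z, 1 ≤ r₁ (insert e Z) := fun Z => hr1 ▸ h₁.mono (by simp)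
    have p2 : ∀ Z, 1 ≤ r₂ (insert e Z) := fun Z => hr2 ▸ h₂.mono (by simp)
    have s1 := h₁.submod A (insert e B)
    have s2 := h₂.submod (G \ A) (insert e (G \ B))
    have e1 : A ∩ insert e B = A ∩ B := inter_insert_of_notMem heA
    have e2 : (G \ A) ∩ insert e (G \ B) = insert e G \ (A ∪ insert e B) := by
      ext x; simp only [mem_inter, mem_sdiff, mem_insert, mem_union]
      have : x = e → x ∉ G := fun h => h ▸ he
      tauto
    have e3 : (G \ A) ∪ insert e (G \ B) = insert e G \ (A ∩ B) := by
      ext x; simp only [mem_inter, mem_sdiff, mem_insert, mem_union]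
      have : x = e → x ∉ A := fun h => h ▸ heA
      tauto
    rw [e1] at s1
    rw [e2, e3] at s2
    have q1 := p1 B
    have q2 := p2 (G \ B)
    -- Uncrossing: by submodularity the values at `A ∩ B` and `A ∪ insert e B` add up to at most `#I
    -- + (#J + 2)`, the dual values from deletion and from contraction of `e`. Hence they cannot
    -- both exceed `max #I (#J + 1)`.
    have key : ∃ A' ⊆ insert e G, r₁ A' + r₂ (insert e G \ A') ≤ max #I (#J + 1) := by
      by_cases hc : r₁ (A ∩ B) + r₂ (insert e G \ (A ∩ B)) ≤ max #I (#J + 1)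
      · exact ⟨_, inter_subset_left.trans (hAG.trans (subset_insert _ _)), hc⟩
      · refine ⟨A ∪ insert e B, union_subset (hAG.trans (subset_insert _ _))
          (insert_subset_insert _ hBG), ?_⟩
        have := le_max_left #I (#J + 1)
        have := le_max_right #I (#J + 1)
        omega
    obtain ⟨A', hA'G, hA'⟩ := key
    rcases max_choice #I (#J + 1) with hm | hm
    · exact ⟨I, hIG.trans (subset_insert _ _), hI1, hI2, A', hA'G, hm ▸ hA'⟩
    · refine ⟨insert e J, insert_subset_insert _ hJG, ?_, ?_, A', hA'G, ?_⟩
      · have := p1 J; rw [card_insert_of_notMem heJ]; omega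
      · have := p2 J; rw [card_insert_of_notMem heJ]; omega
      · rw [card_insert_of_notMem heJ]; omega

end IsRankFun

/-! ### Level sets of weights and the weight splitting theorem. -/

/-- The elements of `G` on which `u` is at least `t`. -/
def upperLevel (G : Finset α) (u : α → ℕ) (t : ℕ) : Finset α := G.filter (fun e => t ≤ u e)

theorem mem_upperLevel {α : Type*} {G : Finset α} {u : α → ℕ} {t : ℕ} {e : α} :
    e ∈ upperLevel G u t ↔ e ∈ G ∧ t ≤ u e := by simp [upperLevel]

theorem upperLevel_zero {α : Type*} (G : Finset α) (u : α → ℕ) : upperLevel G u 0 = G := by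
  ext; simp [mem_upperLevel]

theorem upperLevel_anti {α : Type*} (G : Finset α) (u : α → ℕ) {s t : ℕ} (h : s ≤ t) :
    upperLevel G u t ⊆ upperLevel G u s := fun e he => by
  rw [mem_upperLevel] at he ⊢
  exact ⟨he.1, h.trans he.2⟩

theorem upperLevel_eq_empty {α : Type*} {G : Finset α} {u : α → ℕ} {t : ℕ} (h : G.sup u < t) :
    upperLevel G u t = ∅ := by
  ext e
  simp only [mem_upperLevel, notMem_empty, iff_false, not_and, not_le]
  exact fun he => (le_sup he).trans_lt h

/-- The maximum `u`-weight of an independent subset of `G`, as a sum of ranks of level sets. -/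
def layerSum (r : Finset α → ℕ) (G : Finset α) (u : α → ℕ) : ℕ :=
  ∑ t ∈ range (G.sup u), r (upperLevel G u (t + 1))

theorem layerSum_eq {α : Type*} {r : Finset α → ℕ} (h : r ∅ = 0) {G : Finset α} {u : α → ℕ} {T : ℕ}
    (hT : G.sup u ≤ T) : layerSum r G u = ∑ t ∈ range T, r (upperLevel G u (t + 1)) := by
  refine sum_subset (range_mono hT) fun t _ ht => ?_
  rw [upperLevel_eq_empty (by simpa using ht), h]

/-- The rank function of the matroid whose bases are the `u`-maximal bases of `G`. -/
def levelRank (r : Finset α → ℕ) (G : Finset α) (u : α → ℕ) (A : Finset α) : ℕ :=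
  ∑ t ∈ range (G.sup u + 1),
    (r (upperLevel G u (t + 1) ∪ (A ∩ upperLevel G u t)) - r (upperLevel G u (t + 1)))

namespace IsRankFun

variable {r r₁ r₂ : Finset α → ℕ}

theorem levelRank (h : IsRankFun r) (G : Finset α) (u : α → ℕ) :
    IsRankFun (levelRank r G u) where
  empty := by simp [_root_.levelRank]
  mono X Y hXY := sum_le_sum fun t _ => Nat.sub_le_sub_right (h.mono (by gcongr)) _
  insert_le e X := by
    -- Only the summand `t = u e` can grow: for smaller `t` the element is in the contracted level
    -- already, for larger `t` it is cut off.
    have : _root_.levelRank r G u X + 1 ≥ ∑ t ∈ range (G.sup u + 1),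
        ((r (upperLevel G u (t + 1) ∪ (X ∩ upperLevel G u t)) - r (upperLevel G u (t + 1)))
          + if u e = t then 1 else 0) := by
      rw [sum_add_distrib, _root_.levelRank, sum_ite_eq]
      split_ifs <;> omega
    refine le_trans (sum_le_sum fun t _ => ?_) this
    by_cases he : e ∈ upperLevel G u t
    · rw [insert_inter_of_mem he, union_insert]
      by_cases het : u e = t
      · simp only [het, if_true]
        have := h.insert_le e (upperLevel G u (t + 1) ∪ (X ∩ upperLevel G u t))
        omega
      · have : e ∈ upperLevel G u (t + 1) := by
          rw [mem_upperLevel] at he ⊢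
          exact ⟨he.1, by omega⟩
        rw [insert_eq_of_mem (mem_union_left _ this)]
        omega
    · rw [insert_inter_of_notMem he]
      omega
  submod X Y := by
    rw [_root_.levelRank, _root_.levelRank, _root_.levelRank, _root_.levelRank,
      ← sum_add_distrib, ← sum_add_distrib]
    refine sum_le_sum fun t _ => ?_
    set L := upperLevel G u (t + 1)
    set H := upperLevel G u t
    have h1 := h.submod (L ∪ (X ∩ H)) (L ∪ (Y ∩ H))
    have e1 : (L ∪ (X ∩ H)) ∩ (L ∪ (Y ∩ H)) = L ∪ ((X ∩ Y) ∩ H) := by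
      rw [← union_inter_distrib_left, ← inter_inter_distrib_right]
    have e2 : (L ∪ (X ∩ H)) ∪ (L ∪ (Y ∩ H)) = L ∪ ((X ∪ Y) ∩ H) := by
      rw [← union_union_distrib_left, ← union_inter_distrib_right]
    rw [e1, e2] at h1
    have h2 : ∀ Z, r L ≤ r (L ∪ Z) := fun Z => h.mono subset_union_left
    have := h2 (X ∩ H)
    have := h2 (Y ∩ H)
    have := h2 ((X ∩ Y) ∩ H)
    have := h2 ((X ∪ Y) ∩ H)
    omega

/-- Raising the weights on `A` by one raises the maximum weight by the level rank of `A`. -/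
theorem layerSum_add_indicator (h : IsRankFun r) (G A : Finset α) (u : α → ℕ) :
    layerSum r G (fun e => u e + if e ∈ A then 1 else 0)
      = layerSum r G u + _root_.levelRank r G u A := by
  rw [layerSum_eq h.empty (u := u) (Nat.le_succ (G.sup u)), layerSum_eq h.empty
    (T := G.sup u + 1) (Finset.sup_le fun e he => by
      have := le_sup (f := u) he
      split_ifs <;> omega), _root_.levelRank, ← sum_add_distrib]
  refine sum_congr rfl fun t _ => ?_
  have e1 : upperLevel G (fun e => u e + if e ∈ A then 1 else 0) (t + 1)
      = upperLevel G u (t + 1) ∪ (A ∩ upperLevel G u t) := by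
    ext e
    simp only [mem_upperLevel, mem_union, mem_inter]
    by_cases he : e ∈ A
    · simp only [he, if_true, true_and]
      have : t + 1 ≤ u e + 1 ↔ t + 1 ≤ u e ∨ t ≤ u e := by omega
      rw [this]
      tauto
    · simp [he]
  rw [e1]
  have := h.mono (subset_union_left (s₁ := upperLevel G u (t + 1))
    (s₂ := A ∩ upperLevel G u t))
  omega

theorem sum_level_telescope {f : ℕ → ℕ} (hf : Antitone f) (T : ℕ) :
    ∑ t ∈ range T, (f t - f (t + 1)) + f T = f 0 := by
  induction T with
  | zero => simp
  | succ T ih =>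
    rw [sum_range_succ]
    have := hf (Nat.le_succ T)
    simp only [Nat.succ_eq_add_one] at this
    omega

theorem levelRank_term_le (h : IsRankFun r) (G : Finset α) (u : α → ℕ) (A : Finset α) (t : ℕ) :
    r (upperLevel G u (t + 1) ∪ (A ∩ upperLevel G u t)) - r (upperLevel G u (t + 1))
      ≤ r (upperLevel G u t) - r (upperLevel G u (t + 1)) :=
  Nat.sub_le_sub_right (h.mono (union_subset (upperLevel_anti G u (Nat.le_succ t))
    inter_subset_right)) _

theorem sum_level_ranks (h : IsRankFun r) (G : Finset α) (u : α → ℕ) :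
    ∑ t ∈ range (G.sup u + 1), (r (upperLevel G u t) - r (upperLevel G u (t + 1))) = r G := by
  have := sum_level_telescope (f := fun t => r (upperLevel G u t))
    (fun s t hst => h.mono (upperLevel_anti G u hst)) (G.sup u + 1)
  rw [upperLevel_eq_empty (Nat.lt_succ_self _), h.empty, upperLevel_zero] at this
  simpa using this

theorem levelRank_le (h : IsRankFun r) (G : Finset α) (u : α → ℕ) (A : Finset α) :
    _root_.levelRank r G u A ≤ r G := by
  rw [← h.sum_level_ranks G u]
  exact sum_le_sum fun t _ => h.levelRank_term_le G u A t

/-- An independent set of the level matroid of full rank is an independent set of maximum weight. -/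
theorem indep_of_levelRank_eq (h : IsRankFun r) {G I : Finset α} (hI : I ⊆ G) (u : α → ℕ)
    (h1 : _root_.levelRank r G u I = #I) (h2 : #I = r G) :
    r I = #I ∧ ∑ e ∈ I, u e = layerSum r G u := by
  set T := G.sup u + 1 with hT
  have ha := (sum_eq_sum_iff_of_le (fun t _ => h.levelRank_term_le G u I t)).1
    (show _root_.levelRank r G u I = ∑ t ∈ range T, _ by rw [h.sum_level_ranks, h1, h2])
  have hcard : ∑ t ∈ range T, (#(I ∩ upperLevel G u t) - #(I ∩ upperLevel G u (t + 1))) = #I := by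
    have := sum_level_telescope (f := fun t => #(I ∩ upperLevel G u t))
      (fun s t hst => card_le_card (inter_subset_inter_left (upperLevel_anti G u hst))) T
    rw [upperLevel_eq_empty (Nat.lt_succ_self _), upperLevel_zero, inter_eq_left.2 hI] at this
    simpa using this
  have hle : ∀ t ∈ range T,
      r (upperLevel G u (t + 1) ∪ (I ∩ upperLevel G u t)) - r (upperLevel G u (t + 1))
        ≤ #(I ∩ upperLevel G u t) - #(I ∩ upperLevel G u (t + 1)) := fun t _ => by
    have e1 : upperLevel G u (t + 1) ∪ (I ∩ upperLevel G u t)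
        = upperLevel G u (t + 1) ∪ ((I ∩ upperLevel G u t) \ (I ∩ upperLevel G u (t + 1))) := by
      ext x; simp only [mem_union, mem_inter, mem_sdiff]; tauto
    rw [e1, ← card_sdiff_of_subset (inter_subset_inter_left (upperLevel_anti G u (Nat.le_succ t)))]
    have := h.union_le_add_card (upperLevel G u (t + 1))
      ((I ∩ upperLevel G u t) \ (I ∩ upperLevel G u (t + 1)))
    simp only [Nat.succ_eq_add_one] at this ⊢
    omega
  have hb := (sum_eq_sum_iff_of_le hle).1
    (show _root_.levelRank r G u I = ∑ t ∈ range T, _ by rw [hcard, h1])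
  -- Both termwise equalities `ha` and `hb` are used in a descent from the empty top level: in every
  -- level set, `I` induces an independent set of full rank.
  have key : ∀ s ≤ T, r (I ∩ upperLevel G u (T - s)) = r (upperLevel G u (T - s)) ∧
      #(I ∩ upperLevel G u (T - s)) = r (upperLevel G u (T - s)) := by
    intro s
    induction s with
    | zero =>
      intro _
      simp [upperLevel_eq_empty (G := G) (u := u) (show G.sup u < T by omega), h.empty]
    | succ s ih =>
      intro hs
      obtain ⟨i1, i2⟩ := ih (by omega)
      obtain ⟨t, ht⟩ : ∃ t, t = T - (s + 1) := ⟨_, rfl⟩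
      have ht1 : T - s = t + 1 := by omega
      rw [ht1] at i1 i2
      rw [← ht]
      have ha' := ha t (by simp; omega)
      have hb' := hb t (by simp; omega)
      have m1 := h.mono (upperLevel_anti G u (Nat.le_succ t))
      have m2 := h.mono (subset_union_left (s₁ := upperLevel G u (t + 1))
        (s₂ := I ∩ upperLevel G u t))
      have m3 : r (I ∩ upperLevel G u t) ≤ r (upperLevel G u t) := h.mono inter_subset_right
      have m4 : #(I ∩ upperLevel G u (t + 1)) ≤ #(I ∩ upperLevel G u t) :=
        card_le_card (inter_subset_inter_left (upperLevel_anti G u (Nat.le_succ t)))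
      have m5 := h.submod (upperLevel G u (t + 1)) (I ∩ upperLevel G u t)
      have m6 : r (I ∩ upperLevel G u (t + 1))
          ≤ r (upperLevel G u (t + 1) ∩ (I ∩ upperLevel G u t)) := h.mono fun x hx => by
        simp only [mem_inter] at hx ⊢
        exact ⟨hx.2, hx.1, upperLevel_anti G u (Nat.le_succ t) hx.2⟩
      simp only [Nat.succ_eq_add_one] at m1
      omega
  constructor
  · have := (key T le_rfl).1
    rw [Nat.sub_self, upperLevel_zero, inter_eq_left.2 hI] at this
    rw [this, h2]
  · rw [layerSum_eq h.empty (T := T) (by omega)]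
    have : ∀ t ∈ range T, r (upperLevel G u (t + 1)) = ∑ e ∈ I, if t + 1 ≤ u e then 1 else 0 := by
      intro t ht
      rw [mem_range] at ht
      have := (key (T - (t + 1)) (by omega)).2
      rw [show T - (T - (t + 1)) = t + 1 by omega] at this
      rw [← this, ← card_filter]
      congr 1
      ext x
      simp only [mem_inter, mem_upperLevel, mem_filter]
      exact ⟨fun hx => ⟨hx.1, hx.2.2⟩, fun hx => ⟨hx.1, hI hx.1, hx.2⟩⟩
    rw [sum_congr rfl this, sum_comm]
    refine sum_congr rfl fun e he => ?_
    have hu : u e ≤ G.sup u := le_sup (hI he)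
    rw [← card_filter]
    have : (range T).filter (fun t => t + 1 ≤ u e) = range (u e) := by
      ext t; simp only [mem_filter, mem_range]; omega
    rw [this, card_range]

/-- Weight splitting for common bases, provided that the dual values are nonnegative. -/
theorem exists_common_base (h₁ : IsRankFun r₁) (h₂ : IsRankFun r₂) (G : Finset α) (n : ℕ)
    (hn₁ : r₁ G = n) (hn₂ : r₂ G = n) (w : α → ℕ)
    (hpos : ∀ (u₁ u₂ : α → ℕ) (c : ℕ), (∀ e ∈ G, u₁ e + u₂ e = w e + c) →
      n * c ≤ layerSum r₁ G u₁ + layerSum r₂ G u₂) :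
    ∃ (I : Finset α) (u₁ u₂ : α → ℕ) (c : ℕ), I ⊆ G ∧ r₁ I = #I ∧ r₂ I = #I ∧ #I = n ∧
      (∀ e ∈ G, u₁ e + u₂ e = w e + c) ∧
      ∑ e ∈ I, w e + n * c = layerSum r₁ G u₁ + layerSum r₂ G u₂ := by
  classical
  -- `d` is the duality gap, a natural number by `hpos`; a triple `(u₁, u₂, c)` of minimum gap is
  -- taken.
  have hex : ∃ d : ℕ, ∃ (u₁ u₂ : α → ℕ) (c : ℕ), (∀ e ∈ G, u₁ e + u₂ e = w e + c) ∧
      layerSum r₁ G u₁ + layerSum r₂ G u₂ = n * c + d := by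
    exact ⟨layerSum r₁ G w + layerSum r₂ G 0, w, 0, 0, by simp, by simp⟩
  obtain ⟨u₁, u₂, c, hu, hd⟩ := Nat.find_spec hex
  have hmin := fun m => Nat.find_min (m := m) hex
  set d := Nat.find hex
  obtain ⟨I, hIG, hI1, hI2, A, hAG, hA⟩ :=
    exists_common_indep G (h₁.levelRank G u₁) (h₂.levelRank G u₂)
  have hIn : #I = n := by
    refine le_antisymm (hI1 ▸ hn₁ ▸ h₁.levelRank_le G u₁ I) (not_lt.1 fun hlt => ?_)
    -- If the level matroids have no common independent set of size `n`, raising `u₁` on `A` and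
    -- `u₂` on `G \ A` adds at most `#I < n` to the layer sums and exactly `n` to `n * c`, which
    -- contradicts minimality of the gap.
    have hu' : ∀ e ∈ G, (u₁ e + if e ∈ A then 1 else 0) + (u₂ e + if e ∈ G \ A then 1 else 0)
        = w e + (c + 1) := fun e he => by
      have := hu e he
      by_cases heA : e ∈ A <;> simp [heA, he] <;> omega
    have s1 := h₁.layerSum_add_indicator G A u₁
    have s2 := h₂.layerSum_add_indicator G (G \ A) u₂
    have hp := hpos _ _ _ hu'
    rw [s1, s2] at hp
    refine hmin (layerSum r₁ G u₁ + _root_.levelRank r₁ G u₁ A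
      + (layerSum r₂ G u₂ + _root_.levelRank r₂ G u₂ (G \ A)) - n * (c + 1)) ?_
      ⟨_, _, _, hu', ?_⟩
    · rw [Nat.mul_succ] at hp ⊢
      omega
    · rw [s1, s2]
      omega
  obtain ⟨a1, b1⟩ := h₁.indep_of_levelRank_eq hIG u₁ hI1 (hIn.trans hn₁.symm)
  obtain ⟨a2, b2⟩ := h₂.indep_of_levelRank_eq hIG u₂ hI2 (hIn.trans hn₂.symm)
  refine ⟨I, u₁, u₂, c, hIG, a1, a2, hIn, hu, ?_⟩
  rw [← b1, ← b2, ← sum_add_distrib, sum_congr rfl fun e he => hu e (hIG he), sum_add_distrib,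
    sum_const, hIn, smul_eq_mul]

/-- The rank function of the direct sum with a free matroid, truncated to rank `n`. -/
theorem freeExtension (h : IsRankFun r) (n : ℕ) {β : Type*} [DecidableEq β] :
    IsRankFun (fun X : Finset (α ⊕ β) => min n (r X.toLeft + #X.toRight)) where
  empty := by
    have h1 : (∅ : Finset (α ⊕ β)).toLeft = ∅ := by ext; simp
    have h2 : (∅ : Finset (α ⊕ β)).toRight = ∅ := by ext; simp
    simp [h1, h2, h.empty]
  mono X Y hXY := by
    have := h.mono (toLeft_subset_toLeft hXY)
    have := card_le_card (toRight_subset_toRight hXY)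
    omega
  insert_le e X := by
    rcases e with e | e
    · have := h.insert_le e X.toLeft
      simp only [toLeft_insert_inl, toRight_insert_inl]
      omega
    · have := card_insert_le e X.toRight
      simp only [toLeft_insert_inr, toRight_insert_inr]
      omega
  submod X Y := by
    have h1 := h.submod X.toLeft Y.toLeft
    have h2 := card_inter_add_card_union X.toRight Y.toRight
    rw [toLeft_inter, toRight_inter, toLeft_union, toRight_union]
    have h3 : r (X.toLeft ∩ Y.toLeft) ≤ r X.toLeft := h.mono inter_subset_left
    have h4 : r (X.toLeft ∩ Y.toLeft) ≤ r Y.toLeft := h.mono inter_subset_right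
    have h5 : #(X.toRight ∩ Y.toRight) ≤ #X.toRight := card_le_card inter_subset_left
    have h6 : #(X.toRight ∩ Y.toRight) ≤ #Y.toRight := card_le_card inter_subset_right
    omega

theorem le_layerSum_freeExtension (h : IsRankFun r) {G : Finset α} {β : Type*} [DecidableEq β]
    [Fintype β] (u : α ⊕ β → ℕ) (a : ℕ)
    (ha : #G ≤ #{z : β | a ≤ u (Sum.inr z)}) :
    #G * a + layerSum r G (fun e => u (Sum.inl e) - a)
      ≤ layerSum (fun X : Finset (α ⊕ β) => min #G (r X.toLeft + #X.toRight))
        (G.disjSum univ) u := by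
  set T := (G.disjSum univ).sup u with hT
  rw [layerSum_eq (h.freeExtension #G).empty (show (G.disjSum univ).sup u ≤ a + T by omega),
    sum_range_add]
  rw [layerSum_eq h.empty (T := T) (Finset.sup_le fun e he => (Nat.sub_le _ _).trans
    (le_sup (f := u) (by simpa using he)))]
  -- Each of the lowest `a` levels contains `#G` free elements and so has the full rank `#G`. Higher
  -- levels contain those of the truncated weight, whose rank is not cut down by the truncation to
  -- `#G`.
  refine add_le_add ?_ (sum_le_sum fun t _ => ?_)
  · rw [Nat.mul_comm, ← smul_eq_mul]
    conv_lhs => rw [← card_range a]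
    refine card_nsmul_le_sum _ _ _ fun t ht => le_min le_rfl ?_
    refine ha.trans (le_trans (card_le_card fun z hz => ?_) (Nat.le_add_left _ _))
    simp only [mem_filter, mem_univ, true_and, mem_range] at hz ht
    simp only [mem_toRight, mem_upperLevel, inr_mem_disjSum, mem_univ, true_and]
    omega
  · refine le_min ((h.le_card _).trans (card_le_card fun e he => (mem_upperLevel.1 he).1))
      ((h.mono fun e he => ?_).trans (Nat.le_add_right _ _))
    simp only [mem_upperLevel] at he
    simp only [mem_toLeft, mem_upperLevel, inl_mem_disjSum]
    exact ⟨he.1, by omega⟩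

/-- Frank's weight splitting theorem: the weighted matroid intersection theorem. -/
theorem exists_weight_splitting (h₁ : IsRankFun r₁) (h₂ : IsRankFun r₂) (G : Finset α)
    (w : α → ℕ) : ∃ (I : Finset α) (v₁ v₂ : α → ℕ), I ⊆ G ∧ r₁ I = #I ∧ r₂ I = #I ∧
      (∀ e ∈ G, w e ≤ v₁ e + v₂ e) ∧
      layerSum r₁ G v₁ + layerSum r₂ G v₂ ≤ ∑ e ∈ I, w e := by
  -- Free elements of weight zero pad independent sets to size `#G`, which reduces independent sets
  -- to bases. Their number `2 * #G` is needed for the pigeonhole argument below.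
  let β := Fin (2 * #G)
  have hthr : ∀ (u₁ u₂ : α ⊕ β → ℕ) (c : ℕ),
      (∀ e ∈ G.disjSum univ, u₁ e + u₂ e = Sum.elim w 0 e + c) → ∃ a b, a + b = c ∧
      #G * a + layerSum r₁ G (fun e => u₁ (Sum.inl e) - a)
        ≤ layerSum (fun X : Finset (α ⊕ β) => min #G (r₁ X.toLeft + #X.toRight))
          (G.disjSum univ) u₁ ∧
      #G * b + layerSum r₂ G (fun e => u₂ (Sum.inl e) - b)
        ≤ layerSum (fun X : Finset (α ⊕ β) => min #G (r₂ X.toLeft + #X.toRight))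
          (G.disjSum univ) u₂ := by
    intro u₁ u₂ c hu
    -- On free elements `u₁ + u₂ = c`. For the largest `a ≤ c` such that `#G` of them have `u₁ ≥ a`,
    -- either `a = c` or more than `#G` of them have `u₁ ≤ a`, thus `u₂ ≥ c - a`. So `a` and `c - a`
    -- can be subtracted from the two sides, which also makes the gap nonnegative.
    let Q : ℕ → Prop := fun a => #G ≤ #{z : β | a ≤ u₁ (Sum.inr z)}
    have hQ0 : Q 0 := by simp [Q, β]; omega
    have hQ := Nat.findGreatest_spec (P := Q) (Nat.zero_le c) hQ0
    have hac := Nat.findGreatest_le (P := Q) c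
    have hnot := fun h => Nat.findGreatest_is_greatest (P := Q) (n := c)
      (k := Nat.findGreatest Q c + 1) (Nat.lt_succ_self _) h
    set a := Nat.findGreatest Q c
    refine ⟨a, c - a, by omega, h₁.le_layerSum_freeExtension u₁ a hQ,
      h₂.le_layerSum_freeExtension u₂ (c - a) ?_⟩
    rcases hac.lt_or_eq with hlt | heq
    · have h3 := hnot hlt
      have h4 := card_filter_add_card_filter_not (s := (univ : Finset β))
        (fun z => a + 1 ≤ u₁ (Sum.inr z))
      simp only [Q, not_le] at h3
      have h5 : #{z : β | ¬ a + 1 ≤ u₁ (Sum.inr z)} ≤ #{z : β | c - a ≤ u₂ (Sum.inr z)} := by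
        refine card_le_card fun z hz => ?_
        simp only [mem_filter, mem_univ, true_and] at hz ⊢
        have := hu (Sum.inr z) (by simp)
        simp at this
        omega
      simp only [card_univ, Fintype.card_fin, β] at h4 h3 h5 ⊢
      omega
    · rw [heq]
      simp [β]
      omega
  obtain ⟨I, u₁, u₂, c, hIG, hI1, hI2, hIn, hu, hw⟩ := exists_common_base
    (h₁.freeExtension (β := β) #G) (h₂.freeExtension (β := β) #G) (G.disjSum univ) #G
    (min_eq_left (by simp [β]; omega)) (min_eq_left (by simp [β]; omega)) (Sum.elim w 0)
    (fun u₁ u₂ c hu => by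
      obtain ⟨a, b, hab, ha, hb⟩ := hthr u₁ u₂ c hu
      rw [← hab, Nat.mul_add]
      omega)
  obtain ⟨a, b, hab, ha, hb⟩ := hthr u₁ u₂ c hu
  have hcard := card_toLeft_add_card_toRight (u := I)
  have hl1 := h₁.le_card I.toLeft
  have hl2 := h₂.le_card I.toLeft
  refine ⟨I.toLeft, fun e => u₁ (Sum.inl e) - a, fun e => u₂ (Sum.inl e) - b, ?_, ?_, ?_, ?_, ?_⟩
  · intro e he
    simpa using hIG (mem_toLeft.1 he)
  · omega
  · omega
  · intro e he
    have := hu (Sum.inl e) (by simpa using he)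
    simp only [Sum.elim_inl] at this
    show w e ≤ u₁ (Sum.inl e) - a + (u₂ (Sum.inl e) - b)
    omega
  · have hsum : ∑ e ∈ I, Sum.elim w 0 e = ∑ e ∈ I.toLeft, w e := by
      rw [← toLeft_disjSum_toRight (u := I), sum_disjSum]
      simp
    rw [hsum, ← hab, Nat.mul_add] at hw
    omega

end IsRankFun

end RankFunctions

/-! ### Unfolding weights into copies and folding back. -/

section Unfolding

open Finset

/-- The rank of a finite set in a matroid, as a natural number. -/
def finRank {α : Type*} (M : Matroid α) (X : Finset α) : ℕ := (M.eRk (X : Set α)).toNat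

theorem coe_finRank {α : Type*} (M : Matroid α) (X : Finset α) :
    (finRank M X : ℕ∞) = M.eRk (X : Set α) :=
  ENat.natCast_toNat (M.isRkFinite_of_finite X.finite_toSet).eRk_lt_top.ne

theorem isRankFun_finRank {α : Type*} [DecidableEq α] (M : Matroid α) : IsRankFun (finRank M) where
  empty := by simp [finRank]
  mono X Y h := by
    have := M.eRk_mono (show (X : Set α) ⊆ Y by exact_mod_cast h)
    rw [← coe_finRank, ← coe_finRank] at this
    exact_mod_cast this
  insert_le e X := by
    have := M.eRk_insert_le_add_one e X
    rw [← coe_insert, ← coe_finRank, ← coe_finRank] at this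
    exact_mod_cast this
  submod X Y := by
    have := M.eRk_inter_add_eRk_union_le X Y
    rw [← coe_inter, ← coe_union, ← coe_finRank, ← coe_finRank, ← coe_finRank,
      ← coe_finRank] at this
    exact_mod_cast this

theorem finRank_eq_card_iff {α : Type*} {M : Matroid α} {X : Finset α} :
    finRank M X = #X ↔ M.Indep (X : Set α) := by
  rw [Matroid.indep_iff_eRk_eq_encard_of_finite X.finite_toSet, ← coe_finRank,
    Set.encard_coe_eq_coe_finsetCard]
  norm_cast

theorem card_le_finRank {α : Type*} {M : Matroid α} {X Y : Finset α} (hX : M.Indep (X : Set α))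
    (hXY : X ⊆ Y) : #X ≤ finRank M Y := by
  classical
  rw [← finRank_eq_card_iff.2 hX]
  exact (isRankFun_finRank M).mono hXY

/-- The element of which `x` is a copy. -/
def copyBase (x : ℕ) : ℕ := x.unpair.1

/-- The projections of the elements of `X` that lie in layer `t`. -/
def layer (κ : ℕ → ℕ) (t : ℕ) (X : Finset ℕ) : Finset ℕ :=
  (X.filter (fun x => κ x = t)).image copyBase

/-- No two elements of `X` are copies of the same element in the same layer. -/
def LayerInj (κ : ℕ → ℕ) (X : Finset ℕ) : Prop :=
  ∀ x ∈ X, ∀ y ∈ X, κ x = κ y → copyBase x = copyBase y → x = y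

theorem LayerInj.mono {κ : ℕ → ℕ} {X Y : Finset ℕ} (h : LayerInj κ Y) (hXY : X ⊆ Y) :
    LayerInj κ X := fun x hx y hy => h x (hXY hx) y (hXY hy)

theorem LayerInj.card_layer {κ : ℕ → ℕ} {X : Finset ℕ} (h : LayerInj κ X) (t : ℕ) :
    #(layer κ t X) = #(X.filter (fun x => κ x = t)) := by
  refine card_image_of_injOn fun x hx y hy hxy => ?_
  simp only [coe_filter, Set.mem_ofPred_eq] at hx hy
  exact h x hx.1 y hy.1 (hx.2.trans hy.2.symm) hxy

/-- The direct sum of copies of `M`, one for each layer, restricted to a set `E` of copies. -/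
def unfoldMatroid (M : Matroid ℕ) (κ : ℕ → ℕ) (E : Set ℕ) : Matroid ℕ :=
  ((Matroid.sigma (fun _ : ℕ => M)).comap (fun x => (⟨κ x, copyBase x⟩ : Σ _ : ℕ, ℕ))).restrict E

/-- The preimage construction makes elements with the same image parallel; this accounts for the
condition `LayerInj`. -/
theorem unfoldMatroid_indep_iff {M : Matroid ℕ} {κ : ℕ → ℕ} {E : Set ℕ} {X : Finset ℕ} :
    (unfoldMatroid M κ E).Indep (X : Set ℕ) ↔
      (X : Set ℕ) ⊆ E ∧ LayerInj κ X ∧ ∀ t, M.Indep (layer κ t X : Set ℕ) := by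
  have h1 : ∀ t, Sigma.mk t ⁻¹' ((fun x => (⟨κ x, copyBase x⟩ : Σ _ : ℕ, ℕ)) '' (X : Set ℕ))
      = (layer κ t X : Set ℕ) := by
    intro t
    ext e
    simp only [layer, Set.mem_preimage, Set.mem_image, mem_coe, Sigma.mk.injEq, heq_eq_eq,
      coe_image, coe_filter, Set.mem_ofPred_eq, and_assoc]
  have h2 : Set.InjOn (fun x => (⟨κ x, copyBase x⟩ : Σ _ : ℕ, ℕ)) (X : Set ℕ) ↔ LayerInj κ X := by
    simp only [Set.InjOn, LayerInj, mem_coe, Sigma.mk.injEq, heq_eq_eq, and_imp]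
  rw [unfoldMatroid, Matroid.restrict_indep_iff, Matroid.comap_indep_iff, Matroid.sigma_indep_iff,
    h2]
  simp only [h1]
  tauto

/-- An independent set of the unfolded matroid has at most `v e` elements above each `e` below the
level `v`, so it is bounded by the maximum weight of `v`. -/
theorem card_below_le_layerSum {M : Matroid ℕ} {κ : ℕ → ℕ} {E : Set ℕ} {F G : Finset ℕ}
    (hF : (unfoldMatroid M κ E).Indep (F : Set ℕ)) (hG : F.image copyBase ⊆ G) (v : ℕ → ℕ) :
    #(F.filter (fun x => κ x < v (copyBase x))) ≤ layerSum (finRank M) G v := by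
  obtain ⟨-, hinj, hind⟩ := unfoldMatroid_indep_iff.1 hF
  have hmem : ∀ x ∈ F, copyBase x ∈ G := fun x hx => hG (mem_image_of_mem _ hx)
  rw [card_eq_sum_card_fiberwise (f := κ) (t := range (G.sup v))
    (fun x hx => by
      simp only [coe_filter, Set.mem_ofPred_eq] at hx
      simp only [coe_range, Set.mem_Iio]
      exact hx.2.trans_le (le_sup (f := v) (hmem x hx.1)))]
  refine sum_le_sum fun t _ => ?_
  set F' := F.filter (fun x => κ x < v (copyBase x))
  rw [← (hinj.mono (filter_subset _ _)).card_layer t]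
  refine card_le_finRank ((hind t).subset ?_) fun e he => ?_
  · exact_mod_cast image_subset_image (filter_subset_filter _ (filter_subset _ _))
  · simp only [layer, mem_image, mem_filter] at he
    obtain ⟨x, ⟨⟨hx, hv⟩, rfl⟩, rfl⟩ := he
    exact mem_upperLevel.2 ⟨hmem x hx, hv⟩

namespace MatroidStream

variable {D : Type}

/-- The copies of an element of multiplicity `k`. -/
def copies (k : ℕ) (e : ℕ) : List ℕ := (List.range k).map (Nat.pair e)

theorem mem_copies {k e x : ℕ} : x ∈ copies k e ↔ copyBase x = e ∧ x.unpair.2 < k := by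
  simp only [copies, List.mem_map, List.mem_range, copyBase]
  constructor
  · rintro ⟨i, hi, rfl⟩
    simp [hi]
  · rintro ⟨rfl, h⟩
    exact ⟨_, h, Nat.pair_unpair x⟩

theorem nodup_copies (k e : ℕ) : (copies k e).Nodup :=
  List.nodup_range.map fun _ _ hij => (Nat.pair_eq_pair.1 hij).2

/-- The names of the copies in the unfolded instance, in their order. -/
def unfoldList (μ : ℕ → ℕ) (l : List ℕ) : List ℕ := l.flatMap (fun e => copies (μ e) e)

theorem mem_unfoldList {μ : ℕ → ℕ} {l : List ℕ} {x : ℕ} :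
    x ∈ unfoldList μ l ↔ copyBase x ∈ l ∧ x.unpair.2 < μ (copyBase x) := by
  simp only [unfoldList, List.mem_flatMap, mem_copies]
  constructor
  · rintro ⟨e, he, rfl, h⟩
    exact ⟨he, h⟩
  · rintro ⟨h1, h2⟩
    exact ⟨_, h1, rfl, h2⟩

theorem nodup_unfoldList {μ : ℕ → ℕ} {l : List ℕ} (h : l.Nodup) : (unfoldList μ l).Nodup := by
  rw [unfoldList, List.nodup_flatMap]
  refine ⟨fun e _ => nodup_copies _ _, ?_⟩
  refine h.imp fun {a b} hab => ?_
  rw [Function.onFun, List.disjoint_left]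
  intro x hx hx'
  exact hab ((mem_copies.1 hx).1.symm.trans (mem_copies.1 hx').1)

/-- The key of a copy in the second matroid. -/
def dualKey (μ : ℕ → ℕ) (x : ℕ) : ℕ := μ (copyBase x) - 1 - x.unpair.2

/-- The key of a copy in the first matroid. -/
def primalKey (x : ℕ) : ℕ := x.unpair.2

/-- The unfolded instance: `e` is replaced by `μ e` copies; the `i`-th copy lies in the `i`-th layer
of the first matroid and in the `i`-th layer from the end of the second one. -/
def unfold (I : MatroidStream D) (μ : ℕ → ℕ) : MatroidStream Unit where
  order := unfoldList μ I.order
  nodup := nodup_unfoldList I.nodup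
  M₁ := unfoldMatroid I.M₁ primalKey {x | x ∈ unfoldList μ I.order}
  M₂ := unfoldMatroid I.M₂ (dualKey μ) {x | x ∈ unfoldList μ I.order}
  ground₁ := rfl
  ground₂ := rfl
  data := fun _ => ()

variable {I : MatroidStream D} {μ : ℕ → ℕ}

theorem CommonIndep.subset_order {X : Finset ℕ} (h : I.CommonIndep X) {e : ℕ} (he : e ∈ X) :
    e ∈ I.order := by
  have := h.1.subset_ground (show e ∈ (X : Set ℕ) from he)
  rwa [I.ground₁] at this

theorem CommonIndep.mono {X Y : Finset ℕ} (h : I.CommonIndep Y) (hXY : X ⊆ Y) : I.CommonIndep X :=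
  ⟨h.1.subset (by exact_mod_cast hXY), h.2.subset (by exact_mod_cast hXY)⟩

theorem commonIndep_empty (I : MatroidStream D) : I.CommonIndep ∅ := by
  simp [CommonIndep]

/-- Every common independent set of the unfolded instance can be folded into a common independent
set of the original one without loss of value. -/
theorem exists_refold {F : Finset ℕ} (hF : (I.unfold μ).CommonIndep F) :
    ∃ J ⊆ F.image copyBase, I.CommonIndep J ∧ #F ≤ ∑ e ∈ J, μ e := by
  obtain ⟨J, v₁, v₂, hJ, h1, h2, hv, hw⟩ := (isRankFun_finRank I.M₁).exists_weight_splitting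
    (isRankFun_finRank I.M₂) (F.image copyBase) μ
  refine ⟨J, hJ, ⟨finRank_eq_card_iff.1 h1, finRank_eq_card_iff.1 h2⟩, le_trans ?_ hw⟩
  refine le_trans ?_ (add_le_add (card_below_le_layerSum hF.1 subset_rfl v₁)
    (card_below_le_layerSum hF.2 subset_rfl v₂))
  refine le_trans (card_le_card fun x hx => ?_) (card_union_le _ _)
  have h3 := (mem_unfoldList.1 (hF.subset_order hx)).2
  have h4 := hv _ (mem_image_of_mem copyBase hx)
  rw [mem_union, mem_filter, mem_filter, primalKey, dualKey]
  -- A copy with index `i ≥ v₁ e` has second key `μ e - 1 - i < v₂ e`, since `i < μ e ≤ v₁ e + v₂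
  -- e`.
  by_cases h5 : x.unpair.2 < v₁ (copyBase x)
  · exact Or.inl ⟨hx, h5⟩
  · exact Or.inr ⟨hx, by omega⟩

/-- The set of all copies of the elements of `J`. -/
def unfoldSet (μ : ℕ → ℕ) (J : Finset ℕ) : Finset ℕ :=
  J.biUnion (fun e => (copies (μ e) e).toFinset)

theorem mem_unfoldSet {J : Finset ℕ} {x : ℕ} :
    x ∈ unfoldSet μ J ↔ copyBase x ∈ J ∧ x.unpair.2 < μ (copyBase x) := by
  simp only [unfoldSet, mem_biUnion, List.mem_toFinset, mem_copies]
  constructor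
  · rintro ⟨e, he, rfl, h⟩
    exact ⟨he, h⟩
  · rintro ⟨h1, h2⟩
    exact ⟨_, h1, rfl, h2⟩

theorem card_unfoldSet (μ : ℕ → ℕ) (J : Finset ℕ) : #(unfoldSet μ J) = ∑ e ∈ J, μ e := by
  rw [unfoldSet, card_biUnion]
  · refine sum_congr rfl fun e _ => ?_
    rw [List.toFinset_card_of_nodup (nodup_copies _ _)]
    simp [copies]
  · intro a _ b _ hab
    refine disjoint_left.2 fun x hx hx' => ?_
    rw [List.mem_toFinset, mem_copies] at hx hx'
    exact hab (hx.1.symm.trans hx'.1)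

theorem eq_of_copyBase_eq {x y : ℕ} (h1 : copyBase x = copyBase y) (h2 : x.unpair.2 = y.unpair.2) :
    x = y := by
  rw [← Nat.pair_unpair x, ← Nat.pair_unpair y, h2]
  simp only [copyBase] at h1
  rw [h1]

theorem CommonIndep.unfold {J : Finset ℕ} (hJ : I.CommonIndep J) :
    (I.unfold μ).CommonIndep (unfoldSet μ J) := by
  have hsub : (unfoldSet μ J : Set ℕ) ⊆ {x | x ∈ unfoldList μ I.order} := fun x hx => by
    have := mem_unfoldSet.1 (mem_coe.1 hx)
    exact mem_unfoldList.2 ⟨hJ.subset_order this.1, this.2⟩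
  have hlayer : ∀ κ t, (layer κ t (unfoldSet μ J) : Set ℕ) ⊆ J := fun κ t e he => by
    simp only [layer, coe_image, coe_filter, Set.mem_image, Set.mem_ofPred_eq] at he
    obtain ⟨x, ⟨hx, -⟩, rfl⟩ := he
    exact (mem_unfoldSet.1 hx).1
  constructor
  · exact unfoldMatroid_indep_iff.2 ⟨hsub, fun x _ y _ h1 h2 => eq_of_copyBase_eq h2 h1,
      fun t => hJ.1.subset (hlayer _ _)⟩
  · refine unfoldMatroid_indep_iff.2 ⟨hsub, fun x hx y hy h1 h2 => eq_of_copyBase_eq h2 ?_,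
      fun t => hJ.2.subset (hlayer _ _)⟩
    have hx' := (mem_unfoldSet.1 hx).2
    have hy' := (mem_unfoldSet.1 hy).2
    simp only [dualKey] at h1
    rw [← h2] at h1 hy'
    omega

theorem card_le_size {X : Finset ℕ} (h : I.CommonIndep X) : #X ≤ I.size := by
  rw [size, ← List.toFinset_card_of_nodup I.nodup]
  exact card_le_card fun e he => List.mem_toFinset.2 (h.subset_order he)

theorem bddAbove_card (I : MatroidStream D) :
    BddAbove {k | ∃ X : Finset ℕ, I.CommonIndep X ∧ #X = k} :=
  ⟨I.size, by rintro _ ⟨X, hX, rfl⟩; exact card_le_size hX⟩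

theorem card_le_commonRank {X : Finset ℕ} (h : I.CommonIndep X) : #X ≤ I.commonRank :=
  le_csSup I.bddAbove_card ⟨X, h, rfl⟩

/-- For the constant level `γ` every key lies below the level, and the layer sum consists of `γ`
ranks. -/
theorem eRank_unfoldMatroid_toNat_le {M : Matroid ℕ} {l l' : List ℕ} {κ : ℕ → ℕ} {γ : ℕ}
    (hM : M.E = {e | e ∈ l}) (hκ : ∀ x ∈ l', κ x < γ) :
    (unfoldMatroid M κ {x | x ∈ l'}).eRank.toNat ≤ γ * M.eRank.toNat := by
  obtain ⟨B, hB⟩ := (unfoldMatroid M κ {x | x ∈ l'}).exists_isBase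
  have hfin : B.Finite := (l'.finite_toSet).subset hB.subset_ground
  lift B to Finset ℕ using hfin
  rw [← hB.encard_eq_eRank, Set.encard_coe_eq_coe_finsetCard, ENat.toNat_natCast]
  have h1 := card_below_le_layerSum hB.indep (subset_refl _) (fun _ => γ)
  rw [filter_true_of_mem (fun x hx => hκ x (hB.subset_ground hx))] at h1
  refine h1.trans ?_
  rw [layerSum_eq (isRankFun_finRank M).empty (T := γ) (Finset.sup_le fun _ _ => le_rfl)]
  refine (sum_le_card_nsmul _ _ M.eRank.toNat fun t _ => ?_).trans (by simp)
  have hE : M.E.Finite := hM ▸ l.finite_toSet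
  exact ENat.toNat_le_toNat (M.eRk_le_eRank _)
    ((M.eRank_le_encard_ground.trans_lt hE.encard_lt_top).ne)

theorem length_unfoldList_le {l : List ℕ} {γ : ℕ} (h : ∀ e ∈ l, μ e ≤ γ) :
    (unfoldList μ l).length ≤ γ * l.length := by
  induction l with
  | nil => simp [unfoldList]
  | cons e l ih =>
    have h1 := ih fun x hx => h x (List.mem_cons_of_mem _ hx)
    have h2 := h e List.mem_cons_self
    simp only [unfoldList, List.flatMap_cons, List.length_append, List.length_cons, copies,
      List.length_map, List.length_range] at h1 ⊢
    rw [Nat.mul_succ]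
    omega

theorem params_unfold_le {γ : ℕ} (h : ∀ e ∈ I.order, μ e ≤ γ) :
    (I.unfold μ).params ≤ scaleParams γ I.params := by
  refine ⟨length_unfoldList_le h, ?_, ?_, ?_⟩
  · refine eRank_unfoldMatroid_toNat_le I.ground₁ fun x hx => ?_
    obtain ⟨h1, h2⟩ := mem_unfoldList.1 hx
    exact h2.trans_le (h _ h1)
  · refine eRank_unfoldMatroid_toNat_le I.ground₂ fun x hx => ?_
    obtain ⟨h1, h2⟩ := mem_unfoldList.1 hx
    have := h _ h1
    simp only [dualKey]
    omega
  -- The layers in the two matroids differ, so a single layer of `F` need not be common independent;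
  -- folding is what bounds the common rank.
  · refine csSup_le ⟨0, ∅, commonIndep_empty _, rfl⟩ ?_
    rintro _ ⟨F, hF, rfl⟩
    obtain ⟨J, -, hJ, hle⟩ := exists_refold hF
    calc #F ≤ ∑ e ∈ J, μ e := hle
      _ ≤ #J • γ := sum_le_card_nsmul _ _ _ fun e he => h e (hJ.subset_order he)
      _ = γ * #J := by rw [smul_eq_mul, Nat.mul_comm]
      _ ≤ γ * I.commonRank := Nat.mul_le_mul_left _ (card_le_commonRank hJ)

end MatroidStream

end Unfolding

/-! ### Windows of weights, rounding and merging. -/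

section WeightClasses

open Finset

/-- The weight `d` lies in the window of `q - 1` consecutive powers of `q` above `q ^ a`. -/
def InWindow (q : ℕ) (a : ℤ) (d : ℝ) : Prop := a < Int.log q d ∧ Int.log q d < a + q

open Classical in
/-- The weight `d` in units of `q ^ a`, rounded down, or zero if `d` is outside the window of `a`. -/
def windowMult (q : ℕ) (a : ℤ) (d : ℝ) : ℕ := if InWindow q a d then ⌊d / (q : ℝ) ^ a⌋₊ else 0

section Bounds

variable {q : ℕ} {a : ℤ} {d : ℝ}

theorem InWindow.zpow_le (hq : 2 ≤ q) (hd : 0 < d) (h : InWindow q a d) :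
    (q : ℝ) ^ (a + 1) ≤ d :=
  (zpow_le_zpow_right₀ (by norm_cast; omega) h.1).trans (Int.zpow_log_le_self (by omega) hd)


theorem inWindow_of_windowMult_pos (h : 0 < windowMult q a d) : InWindow q a d := by
  by_contra hn
  simp [windowMult, hn] at h

theorem InWindow.two_le (h : InWindow q a d) : 2 ≤ q := by
  have := h.1
  have := h.2
  omega

theorem InWindow.lt_zpow (h : InWindow q a d) : d < (q : ℝ) ^ (a + q) :=
  have hq := h.two_le
  (Int.lt_zpow_succ_log_self (b := q) (by omega) d).trans_le
    (zpow_le_zpow_right₀ (by norm_cast; omega) h.2)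

theorem windowMult_le : windowMult q a d ≤ q ^ q := by
  unfold windowMult
  split_ifs with h
  · have hq := h.two_le
    have hq0 : (0 : ℝ) < q := by norm_cast; omega
    refine Nat.floor_le_of_le ?_
    rw [div_le_iff₀ (zpow_pos hq0 a)]
    refine (h.lt_zpow).le.trans_eq ?_
    rw [zpow_add₀ hq0.ne', zpow_natCast, mul_comm]
    push_cast
    rfl
  · exact Nat.zero_le _

theorem windowMult_mul_le (hq : 2 ≤ q) (hd : 0 < d) : (q : ℝ) ^ a * windowMult q a d ≤ d := by
  have hq0 : (0 : ℝ) < (q : ℝ) ^ a := zpow_pos (by norm_cast; omega) a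
  unfold windowMult
  split_ifs with h
  · have := Nat.floor_le (div_pos hd hq0).le
    rw [le_div_iff₀ hq0] at this
    linarith
  · simpa using hd.le

theorem le_windowMult_mul (hq : 2 ≤ q) (hd : 0 < d) (h : InWindow q a d) :
    (1 - 1 / q) * d ≤ (q : ℝ) ^ a * windowMult q a d := by
  have hq1 : (0 : ℝ) < q := by norm_cast; omega
  have hq0 : (0 : ℝ) < (q : ℝ) ^ a := zpow_pos hq1 a
  have h1 := h.zpow_le hq hd
  rw [zpow_add_one₀ hq1.ne'] at h1
  have h2 := Nat.lt_floor_add_one (d / (q : ℝ) ^ a)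
  rw [div_lt_iff₀ hq0] at h2
  -- The window excludes the logarithm `a` itself, so one unit of rounding is at most `d / q`.
  have h3 : (q : ℝ) ^ a ≤ 1 / q * d := by
    rw [one_div, inv_mul_eq_div, le_div_iff₀ hq1]
    exact h1
  simp only [windowMult, h, if_true]
  nlinarith

end Bounds

/-- The windows which contain the weight `d`. -/
def windowsOf (q : ℕ) (d : ℝ) : Finset ℤ := Ioo (Int.log q d - q) (Int.log q d)

theorem mem_windowsOf {q : ℕ} {a : ℤ} {d : ℝ} : a ∈ windowsOf q d ↔ InWindow q a d := by
  simp only [windowsOf, mem_Ioo, InWindow]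
  omega

theorem card_windowsOf (q : ℕ) (d : ℝ) : #(windowsOf q d) = q - 1 := by
  rw [windowsOf, Int.card_Ioo]
  omega

/-- A maximal independent subset of `T ∪ J` containing `T` has at least `#J` elements, at most `#T`
of them outside `J`. -/
theorem exists_extension {M : Matroid ℕ} {T J : Finset ℕ} (hT : M.Indep (T : Set ℕ))
    (hJ : M.Indep (J : Set ℕ)) :
    ∃ X ⊆ J, M.Indep ((T ∪ X : Finset ℕ) : Set ℕ) ∧ #(J \ X) ≤ #T := by
  obtain ⟨B, hB, hTB⟩ := hT.subset_isBasis'_of_subset (show (T : Set ℕ) ⊆ (T ∪ J : Finset ℕ) by simp)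
  have hfin : B.Finite := (T ∪ J).finite_toSet.subset hB.subset
  lift B to Finset ℕ using hfin
  have hBs : B ⊆ T ∪ J := by exact_mod_cast hB.subset
  have hTB' : T ⊆ B := by exact_mod_cast hTB
  refine ⟨B ∩ J, inter_subset_right, hB.indep.subset ?_, ?_⟩
  · exact_mod_cast union_subset hTB' inter_subset_left
  · have h1 : (#J : ℕ∞) ≤ #B := by
      rw [← Set.encard_coe_eq_coe_finsetCard, ← Set.encard_coe_eq_coe_finsetCard,
        hB.encard_eq_eRk]
      exact hJ.encard_le_eRk_of_subset (by simp)
    have h1' : #J ≤ #B := by exact_mod_cast h1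
    have h2 : #B ≤ #T + #(B ∩ J) := by
      refine (card_le_card fun x hx => ?_).trans (card_union_le T (B ∩ J))
      have := hBs hx
      simp only [mem_union, mem_inter] at this ⊢
      tauto
    have h3 := card_sdiff_add_card_inter J (B ∩ J)
    rw [inter_eq_right.2 inter_subset_right] at h3
    omega

namespace MatroidStream

/-- Each matroid forbids at most `#T` elements of `J`; the kept sets are intersected. -/
theorem CommonIndep.exists_union {D : Type} {I : MatroidStream D} {T J : Finset ℕ}
    (hT : I.CommonIndep T) (hJ : I.CommonIndep J) :
    ∃ X ⊆ J, I.CommonIndep (T ∪ X) ∧ #(J \ X) ≤ 2 * #T := by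
  obtain ⟨X, hX, hXi, hXc⟩ := exists_extension hT.1 hJ.1
  obtain ⟨Y, hY, hYi, hYc⟩ := exists_extension hT.2 hJ.2
  refine ⟨X ∩ Y, inter_subset_left.trans hX, ⟨hXi.subset ?_, hYi.subset ?_⟩, ?_⟩
  · exact_mod_cast union_subset_union_right inter_subset_left
  · exact_mod_cast union_subset_union_right inter_subset_right
  · have e1 : J \ (X ∩ Y) = (J \ X) ∪ (J \ Y) := by
      ext x; simp only [mem_sdiff, mem_inter, mem_union]; tauto
    rw [e1]
    have := card_union_le (J \ X) (J \ Y)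
    omega

variable {I : MatroidStream ℝ} {q : ℕ}

/-- Common independent sets in windows that are at least `q` apart can be merged, from the heaviest
window to the lightest, at a loss of a factor `1 + 4 / q`. -/
theorem exists_merge (hq : 2 ≤ q) (hI : I.PositiveWeights) (J : ℤ → Finset ℕ) (R : Finset ℤ) :
    (∀ a ∈ R, ∀ b ∈ R, a < b → a + q ≤ b) → (∀ a ∈ R, I.CommonIndep (J a)) →
    (∀ a ∈ R, ∀ e ∈ J a, InWindow q a (I.data e)) →
    ∃ T ⊆ R.biUnion J, I.CommonIndep T ∧ ∀ a : ℤ, (∀ b ∈ R, a ≤ b) →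
      ∑ b ∈ R, I.weight (J b) + 4 * #T * (q : ℝ) ^ a ≤ (1 + 4 / q) * I.weight T := by
  have hq1 : (1 : ℝ) < q := by norm_cast
  have hq0 : (0 : ℝ) < q := by linarith
  -- Windows are added from heavy to light. The term `4 * #T * q ^ a` is a reserve that pays for the
  -- elements of lighter windows displaced by `T`.
  induction R using Finset.induction_on_min with
  | empty => exact fun _ _ _ => ⟨∅, by simp, I.commonIndep_empty, by simp [weight]⟩
  | insert a R haR ih =>
    intro hs hJ hw
    have haR' : a ∉ R := fun h => lt_irrefl _ (haR a h)
    obtain ⟨T, hTR, hT, hTw⟩ := ih (fun b hb c hc => hs b (by simp [hb]) c (by simp [hc]))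
      (fun b hb => hJ b (by simp [hb])) (fun b hb => hw b (by simp [hb]))
    have hJa := hJ a (by simp)
    obtain ⟨X, hXJ, hTX, hcard⟩ := hT.exists_union hJa
    have hbig : ∀ e ∈ T, (q : ℝ) ^ (a + q) ≤ I.data e := fun e he => by
      obtain ⟨b, hb, heb⟩ := mem_biUnion.1 (hTR he)
      refine le_trans (zpow_le_zpow_right₀ hq1.le ?_)
        ((hw b (by simp [hb]) e heb).zpow_le hq (hI e (hT.subset_order he)))
      have := hs a (by simp) b (by simp [hb]) (haR b hb)
      omega
    have hsmall : ∀ e ∈ J a, I.data e < (q : ℝ) ^ (a + q) := fun e he =>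
      (hw a (by simp) e he).lt_zpow
    have hdisj : Disjoint T X := disjoint_left.2 fun e he he' =>
      absurd (hsmall e (hXJ he')) (not_lt.2 (hbig e he))
    refine ⟨T ∪ X, ?_, hTX, fun a' ha' => ?_⟩
    · rw [biUnion_insert]
      exact union_subset (hTR.trans subset_union_right) (hXJ.trans subset_union_left)
    · have haa : a' ≤ a := ha' a (by simp)
      -- At level `a + q` the reserve is `4 * #T * q ^ (a + q)`. Half pays for the at most `2 * #T`
      -- lost elements of `J a`, and the other half covers the new reserve of `T`. The reserve of
      -- `X` is charged to `4 / q` times its own weight.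
      have h1 := hTw (a + q) fun b hb => hs a (by simp) b (by simp [hb]) (haR b hb)
      have h2 : I.weight (J a) = I.weight (J a \ X) + I.weight X := (sum_sdiff hXJ).symm
      have h3 : I.weight (J a \ X) ≤ 2 * #T * (q : ℝ) ^ (a + q) := by
        refine (sum_le_card_nsmul _ _ _ fun e he => (hsmall e (mem_sdiff.1 he).1).le).trans ?_
        rw [nsmul_eq_mul]
        gcongr
        exact_mod_cast hcard
      have h4 : #X * ((q : ℝ) ^ a * q) ≤ I.weight X := by
        rw [← zpow_add_one₀ hq0.ne', ← nsmul_eq_mul]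
        exact card_nsmul_le_sum _ _ _ fun e he =>
          (hw a (by simp) e (hXJ he)).zpow_le hq (hI e (hJa.subset_order (hXJ he)))
      have h5 : (q : ℝ) ^ a' ≤ (q : ℝ) ^ a := zpow_le_zpow_right₀ hq1.le haa
      have h6 : 2 * (q : ℝ) ^ a ≤ (q : ℝ) ^ (a + q) := by
        rw [zpow_add₀ hq0.ne', mul_comm]
        gcongr
        calc (2 : ℝ) ≤ q := by exact_mod_cast hq
          _ = (q : ℝ) ^ (1 : ℤ) := by simp
          _ ≤ (q : ℝ) ^ (q : ℤ) := zpow_le_zpow_right₀ hq1.le (by omega)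
      have h7 : I.weight (T ∪ X) = I.weight T + I.weight X := sum_union hdisj
      have h8 : 4 * #X * (q : ℝ) ^ a ≤ 4 / q * I.weight X := by
        rw [div_mul_eq_mul_div, le_div_iff₀ hq0]
        nlinarith
      have h9 : (0 : ℝ) ≤ #T := Nat.cast_nonneg _
      have h10 : (0 : ℝ) ≤ #X := Nat.cast_nonneg _
      have h11 : 4 * #X * (q : ℝ) ^ a' ≤ 4 * #X * (q : ℝ) ^ a := by gcongr
      have h12 : 4 * #T * (q : ℝ) ^ a' ≤ 2 * (#T * (q : ℝ) ^ (a + q)) := by nlinarith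
      rw [sum_insert haR', h7, card_union_of_disjoint hdisj, h2]
      push_cast
      linarith

/-- The windows that contain the weight of some element of the instance. -/
def windows (I : MatroidStream ℝ) (q : ℕ) : Finset ℤ :=
  I.order.toFinset.biUnion fun e => windowsOf q (I.data e)

/-- The instance on the window `a`, unfolded. -/
def windowInstance (I : MatroidStream ℝ) (q : ℕ) (a : ℤ) : MatroidStream Unit :=
  I.unfold fun e => windowMult q a (I.data e)

/-- Solutions for the windows of one residue class combine to a solution of the whole. -/
theorem exists_combined (hq : 2 ≤ q) (hI : I.PositiveWeights) (F : ℤ → Finset ℕ) (R : Finset ℤ)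
    (s : ℤ) (hF : ∀ a ∈ R, (I.windowInstance q a).CommonIndep (F a)) :
    ∃ T ⊆ R.biUnion (fun a => (F a).image copyBase), I.CommonIndep T ∧
      ∑ a ∈ R.filter (fun a => a % q = s), (q : ℝ) ^ a * #(F a) ≤ (1 + 4 / q) * I.weight T := by
  classical
  set R' := R.filter (fun a => a % q = s)
  have hch : ∀ a : ℤ, ∃ J : Finset ℕ, a ∈ R' → J ⊆ (F a).image copyBase ∧ I.CommonIndep J ∧
      #(F a) ≤ ∑ e ∈ J, windowMult q a (I.data e) := fun a => by
    by_cases ha : a ∈ R'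
    · obtain ⟨J, hJ⟩ := exists_refold (hF a (filter_subset _ _ ha))
      exact ⟨J, fun _ => hJ⟩
    · exact ⟨∅, fun h => absurd h ha⟩
  choose J hJ using hch
  obtain ⟨T, hTR, hT, hTw⟩ := exists_merge hq hI J R'
    (fun a ha b hb hab => by
      have ha' := (mem_filter.1 ha).2
      have hb' := (mem_filter.1 hb).2
      have h1 : (q : ℤ) ∣ b - a := Int.ModEq.dvd (n := (q : ℤ)) (ha'.trans hb'.symm)
      have := Int.le_of_dvd (by omega) h1
      omega)
    (fun a ha => (hJ a ha).2.1)
    (fun a ha e he => by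
      obtain ⟨x, hx, rfl⟩ := mem_image.1 ((hJ a ha).1 he)
      have := mem_unfoldList.1 ((hF a (filter_subset _ _ ha)).subset_order hx)
      exact inWindow_of_windowMult_pos ((Nat.zero_le _).trans_lt this.2))
  refine ⟨T, hTR.trans fun e he => ?_, hT, ?_⟩
  · obtain ⟨a, ha, he⟩ := mem_biUnion.1 he
    exact mem_biUnion.2 ⟨a, filter_subset _ _ ha, (hJ a ha).1 he⟩
  · have hlow : ∃ a : ℤ, ∀ b ∈ R', a ≤ b := by
      obtain ⟨a, ha⟩ := R'.bddBelow
      exact ⟨a, fun b hb => ha hb⟩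
    obtain ⟨a₀, ha₀⟩ := hlow
    refine le_trans ?_ (hTw a₀ ha₀)
    have h0 : (0 : ℝ) ≤ 4 * #T * (q : ℝ) ^ a₀ := by positivity
    refine le_trans (sum_le_sum fun a ha => ?_) (le_add_of_nonneg_right h0)
    calc (q : ℝ) ^ a * #(F a) ≤ (q : ℝ) ^ a * ((∑ e ∈ J a, windowMult q a (I.data e) : ℕ) : ℝ) := by
          gcongr
          exact (hJ a ha).2.2
      _ = ∑ e ∈ J a, (q : ℝ) ^ a * windowMult q a (I.data e) := by
          push_cast
          rw [mul_sum]
      _ ≤ I.weight (J a) := sum_le_sum fun e he =>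
          windowMult_mul_le hq (hI e ((hJ a ha).2.1.subset_order he))

/-- Some residue class of windows retains all but a `1 / q` fraction of the weight of `J`. -/
theorem exists_residue (hq : 2 ≤ q) {J : Finset ℕ} (hJ : ∀ e ∈ J, e ∈ I.order) :
    ∃ s : ℤ, (1 - 1 / q) * I.weight J ≤
      ∑ a ∈ (I.windows q).filter (fun a => a % q = s),
        I.weight (J.filter fun e => a ∈ windowsOf q (I.data e)) := by
  have hq0 : (0 : ℝ) < q := by norm_cast; omega
  -- Each element is in `q - 1` windows and there are `q` residue classes, so the average class gets
  -- a fraction `(q - 1) / q`.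
  have htot : ∑ a ∈ I.windows q, I.weight (J.filter fun e => a ∈ windowsOf q (I.data e))
      = (q - 1) * I.weight J := by
    simp only [weight, sum_filter]
    rw [sum_comm, mul_sum]
    refine sum_congr rfl fun e he => ?_
    rw [← sum_filter, sum_const, nsmul_eq_mul]
    congr 1
    have : (I.windows q).filter (fun a => a ∈ windowsOf q (I.data e)) = windowsOf q (I.data e) := by
      ext a
      simp only [mem_filter, windows, mem_biUnion, List.mem_toFinset]
      exact ⟨fun h => h.2, fun h => ⟨⟨e, hJ e he, h⟩, h⟩⟩
    rw [this, card_windowsOf, Nat.cast_sub (by omega), Nat.cast_one]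
  have hfib := sum_fiberwise_of_maps_to (s := I.windows q) (t := Ico (0 : ℤ) q)
    (g := fun a => a % (q : ℤ)) (fun a _ => by
      rw [mem_Ico]
      exact ⟨Int.emod_nonneg _ (by omega), Int.emod_lt_of_pos _ (by omega)⟩)
    (fun a => I.weight (J.filter fun e => a ∈ windowsOf q (I.data e)))
  rw [htot] at hfib
  obtain ⟨s, -, hs⟩ := exists_le_of_sum_le (s := Ico (0 : ℤ) q)
    (f := fun _ => (1 - 1 / (q : ℝ)) * I.weight J) (nonempty_Ico.2 (by omega))
    (le_of_eq (Eq.trans (by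
      rw [sum_const, nsmul_eq_mul, Int.card_Ico]
      simp only [sub_zero, Int.toNat_natCast]
      field_simp) hfib.symm))
  exact ⟨s, hs⟩

/-- The part of `J` in a window is a solution of the window instance of almost the same value. -/
theorem weight_window_le (hq : 2 ≤ q) (hI : I.PositiveWeights) {J : Finset ℕ}
    (hJ : ∀ e ∈ J, e ∈ I.order) (a : ℤ) :
    (1 - 1 / q) * I.weight (J.filter fun e => a ∈ windowsOf q (I.data e)) ≤
      (q : ℝ) ^ a * #(unfoldSet (fun e => windowMult q a (I.data e))
        (J.filter fun e => a ∈ windowsOf q (I.data e))) := by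
  rw [card_unfoldSet, weight, mul_sum]
  push_cast
  rw [mul_sum]
  refine sum_le_sum fun e he => ?_
  rw [mem_filter] at he
  exact le_windowMult_mul hq (hI e (hJ e he.1)) (mem_windowsOf.1 he.2)

end MatroidStream

end WeightClasses

/-! ### The streaming algorithm: parallel simulation on all windows. -/

section WindowAlgorithm

open Finset

/-- A group of three memory cells that represents one memory cell of the run on a window: an element
`e` with its weight `d`, the distance of `d` to the window, and a code for the content. -/
structure TaggedCell where
  e : ℕ
  d : ℝ
  shift : ℕ
  code : ℕ

namespace TaggedCell

/-- The memory cells occupied by a list of tagged cells. -/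
def encode (τ : List TaggedCell) : List (Cell ℝ) :=
  τ.flatMap fun t => [Cell.elem t.e t.d, Cell.word t.shift, Cell.word t.code]

/-- The inverse of `encode`. -/
def decode : List (Cell ℝ) → List TaggedCell
  | Cell.elem e d :: Cell.word j :: Cell.word v :: m => ⟨e, d, j, v⟩ :: decode m
  | _ => []

theorem decode_encode (τ : List TaggedCell) : decode (encode τ) = τ := by
  induction τ with
  | nil => simp [encode, decode]
  | cons t τ ih =>
    simp only [encode, List.flatMap_cons, List.cons_append, List.nil_append, decode] at ih ⊢
    rw [ih]

theorem elem_mem_encode {τ : List TaggedCell} {e : ℕ} {d : ℝ} :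
    Cell.elem e d ∈ encode τ ↔ ∃ t ∈ τ, t.e = e ∧ t.d = d := by
  simp only [encode, List.mem_flatMap, List.mem_cons, Cell.elem.injEq, reduceCtorEq,
    List.not_mem_nil, or_self, or_false]
  simp only [eq_comm]

theorem word_mem_encode {τ : List TaggedCell} {k : ℕ} :
    Cell.word k ∈ encode τ ↔ ∃ t ∈ τ, k = t.shift ∨ k = t.code := by
  simp [encode]

theorem length_encode (τ : List TaggedCell) : (encode τ).length = 3 * τ.length := by
  induction τ with
  | nil => rfl
  | cons t τ ih =>
    simp only [encode, List.flatMap_cons, List.length_append, List.length_cons,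
      List.length_nil] at ih ⊢
    omega

theorem mem_storedElems_encode {τ : List TaggedCell} {e : ℕ} :
    e ∈ storedElems (encode τ) ↔ ∃ t ∈ τ, t.e = e := by
  simp only [storedElems, Set.mem_ofPred_eq, elem_mem_encode]
  exact ⟨fun ⟨d, t, ht, h, _⟩ => ⟨t, ht, h⟩, fun ⟨t, ht, h⟩ => ⟨t.d, t, ht, h, rfl⟩⟩

/-- The window to whose run the tagged cell belongs. -/
def window (q : ℕ) (t : TaggedCell) : ℤ := Int.log q t.d - t.shift

/-- The memory cell represented by a tagged cell. -/
def toCell (t : TaggedCell) : Cell Unit :=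
  if t.code % 2 = 0 then Cell.elem (Nat.pair t.e (t.code / 2)) () else Cell.word (t.code / 2)

/-- The memory of the run on the window `a`. -/
def runMem (q : ℕ) (a : ℤ) (τ : List TaggedCell) : List (Cell Unit) :=
  (τ.filter fun t => t.window q = a).map toCell

/-- The tagged cell which represents a cell of the run on the window `a`, given the weights `wt` of
the stored elements and an element `e` of weight `d` in the window. -/
def ofCell (q : ℕ) (a : ℤ) (wt : ℕ → ℝ) (e : ℕ) (d : ℝ) : Cell Unit → TaggedCell
  | Cell.elem x _ => ⟨copyBase x, wt (copyBase x), (Int.log q (wt (copyBase x)) - a).toNat,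
      2 * x.unpair.2⟩
  -- An auxiliary word is attached to the element being read, which lies in the window whenever the
  -- run is rewritten. The parity of the code separates words from copies.
  | Cell.word k => ⟨e, d, (Int.log q d - a).toNat, 2 * k + 1⟩

theorem toCell_ofCell (q : ℕ) (a : ℤ) (wt : ℕ → ℝ) (e : ℕ) (d : ℝ) (c : Cell Unit) :
    (ofCell q a wt e d c).toCell = c := by
  rcases c with ⟨x, u⟩ | k
  · simp [ofCell, toCell, copyBase, Nat.pair_unpair]
  · have h2 : (2 * k + 1) / 2 = k := by omega
    simp [ofCell, toCell, h2]

theorem length_eq_sum_runMem {q : ℕ} {s : Finset ℤ} : ∀ {τ : List TaggedCell},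
    (∀ t ∈ τ, t.window q ∈ s) → τ.length = ∑ a ∈ s, (runMem q a τ).length
  | [], _ => by simp [runMem]
  | t :: τ, h => by
    have ih := length_eq_sum_runMem (τ := τ) fun t' ht' => h t' (List.mem_cons_of_mem _ ht')
    have h1 : ∀ a, (runMem q a (t :: τ)).length
        = (runMem q a τ).length + if t.window q = a then 1 else 0 := fun a => by
      by_cases hta : t.window q = a <;> simp [runMem, hta]
    simp only [h1]
    rw [sum_add_distrib, ← ih, sum_ite_eq, if_pos (h t List.mem_cons_self), List.length_cons]

end TaggedCell

open TaggedCell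

open Classical in
/-- The weight of a stored element. -/
def storedWeight (τ : List TaggedCell) (x : ℕ) : ℝ :=
  if h : ∃ t ∈ τ, t.e = x then h.choose.d else 0

theorem storedWeight_spec {τ : List TaggedCell} {x : ℕ} (h : ∃ t ∈ τ, t.e = x) :
    ∃ t ∈ τ, t.e = x ∧ t.d = storedWeight τ x := by
  rw [storedWeight, dif_pos h]
  exact ⟨_, h.choose_spec.1, h.choose_spec.2, rfl⟩

/-- The weight of an element that is stored or just being read. -/
def availWeight (τ : List TaggedCell) (e : ℕ) (d : ℝ) (x : ℕ) : ℝ :=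
  if x = e then d else storedWeight τ x

/-- The independence oracle of an unfolded matroid, by means of an oracle for the matroid. -/
def unfoldOracle (κ : ℕ → ℕ) (o : IndepOracle) (avail : Set ℕ) : IndepOracle :=
  fun X => (X : Set ℕ) ⊆ avail ∧ LayerInj κ X ∧ ∀ t, o (layer κ t X)

theorem layer_congr {κ κ' : ℕ → ℕ} {X : Finset ℕ} (h : ∀ x ∈ X, κ x = κ' x) (t : ℕ) :
    layer κ t X = layer κ' t X := by
  rw [layer, layer, filter_congr fun x hx => by rw [h x hx]]

theorem layerInj_congr {κ κ' : ℕ → ℕ} {X : Finset ℕ} (h : ∀ x ∈ X, κ x = κ' x) :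
    LayerInj κ X ↔ LayerInj κ' X :=
  forall₂_congr fun x hx => forall₂_congr fun y hy => by rw [h x hx, h y hy]

theorem localOracle_unfoldMatroid {M : Matroid ℕ} {κ κ' : ℕ → ℕ} {E avail avail' : Set ℕ}
    (h1 : avail' ⊆ E) (h2 : ∀ x ∈ avail', copyBase x ∈ avail) (h3 : ∀ x ∈ avail', κ x = κ' x) :
    localOracle (unfoldMatroid M κ E) avail' = unfoldOracle κ' (localOracle M avail) avail' := by
  funext X
  refine propext (and_congr_right fun hX => ?_)
  have hk : ∀ x ∈ X, κ x = κ' x := fun x hx => h3 x (hX hx)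
  rw [unfoldMatroid_indep_iff, layerInj_congr hk]
  simp only [layer_congr hk, localOracle]
  have h4 : ∀ t, (layer κ' t X : Set ℕ) ⊆ avail := fun t e he => by
    simp only [layer, coe_image, coe_filter, Set.mem_image, Set.mem_ofPred_eq] at he
    obtain ⟨x, ⟨hx, -⟩, rfl⟩ := he
    exact h2 x (hX hx)
  exact ⟨fun h => ⟨h.2.1, fun t => ⟨h4 t, h.2.2 t⟩⟩,
    fun h => ⟨hX.trans h1, h.1, fun t => (h.2 t).2⟩⟩

namespace StreamAlg

variable {D : Type}

theorem storedElems_readElem (A : StreamAlg D) (I : MatroidStream D) (j : ℕ) (m : List (Cell D))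
    (x : ℕ) : storedElems (A.readElem I j m x) ⊆ insert x (storedElems m) := by
  rintro y ⟨d, hd⟩
  rcases A.step_elem _ _ _ _ _ _ _ hd with h | h
  · exact Or.inr ⟨d, h⟩
  · exact Or.inl (congrArg Prod.fst h)

theorem storedElems_foldl (A : StreamAlg D) (I : MatroidStream D) (j : ℕ) {s : Set ℕ} :
    ∀ (l : List ℕ) (m : List (Cell D)), storedElems m ⊆ s → (∀ x ∈ l, x ∈ s) →
      storedElems (l.foldl (A.readElem I j) m) ⊆ s
  | [], _, h, _ => h
  | x :: l, m, h, hl => A.storedElems_foldl I j l _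
      ((A.storedElems_readElem I j m x).trans (Set.insert_subset (hl x List.mem_cons_self) h))
      fun y hy => hl y (List.mem_cons_of_mem _ hy)

variable (A : StreamAlg Unit) (q : ℕ)

/-- The run on the window `a` processes the copies of the element `e` of weight `d`. -/
def runStep (j : ℕ) (o₁ o₂ : IndepOracle) (τ : List TaggedCell) (e : ℕ) (d : ℝ) (a : ℤ) :
    List (Cell Unit) :=
  (MatroidStream.copies (windowMult q a d) e).foldl (fun m x => A.step j
    (unfoldOracle MatroidStream.primalKey o₁ (insert x (storedElems m)))
    (unfoldOracle (MatroidStream.dualKey fun y => windowMult q a (availWeight τ e d y)) o₂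
      (insert x (storedElems m))) m (x, ())) (runMem q a τ)

/-- All runs process the element `e` of weight `d`. -/
def windowStep (j : ℕ) (o₁ o₂ : IndepOracle) (τ : List TaggedCell) (e : ℕ) (d : ℝ) :
    List TaggedCell :=
  (τ.filter fun t => t.window q ∉ windowsOf q d) ++ (windowsOf q d).toList.flatMap fun a =>
    (A.runStep q j o₁ o₂ τ e d a).map (ofCell q a (availWeight τ e d) e d)

open Classical in
/-- A set of maximum weight in a family. -/
def bestSet (C : Finset (Finset ℕ)) (w : ℕ → ℝ) : Finset ℕ :=
  if h : C.Nonempty then (C.exists_max_image (fun X => ∑ e ∈ X, w e) h).choose else ∅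

theorem bestSet_spec {C : Finset (Finset ℕ)} (h : C.Nonempty) (w : ℕ → ℝ) :
    bestSet C w ∈ C ∧ ∀ X ∈ C, ∑ e ∈ X, w e ≤ ∑ e ∈ bestSet C w, w e := by
  rw [bestSet, dif_pos h]
  exact (C.exists_max_image (fun X => ∑ e ∈ X, w e) h).choose_spec

open Classical in
/-- The elements with a copy in the output of one of the runs. -/
def outputUnion (o₁ o₂ : IndepOracle) (m : List (Cell ℝ)) : Finset ℕ :=
  (((decode m).map (window q)).toFinset.biUnion fun a =>
    (A.output (unfoldOracle MatroidStream.primalKey o₁ (storedElems (runMem q a (decode m))))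
      (unfoldOracle (MatroidStream.dualKey fun y => windowMult q a (storedWeight (decode m) y)) o₂
        (storedElems (runMem q a (decode m)))) (runMem q a (decode m))).image copyBase).filter
    (· ∈ storedElems m)

open Classical in
/-- The algorithm for weighted matroid intersection which runs `A` on the unfolded instance of each
window and outputs the best common independent set in the union of the outputs. -/
def windowAlg : StreamAlg ℝ where
  step j o₁ o₂ m x :=
    if ∀ e d, Cell.elem e d ∈ encode (A.windowStep q j o₁ o₂ (decode m) x.1 x.2) →
      Cell.elem e d ∈ m ∨ (e, d) = x then encode (A.windowStep q j o₁ o₂ (decode m) x.1 x.2)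
    else []
  -- Intersecting with the union makes `output_elem` immediate. Weights are set to zero off the
  -- union so that the choice depends only on the union and the instance.
  output o₁ o₂ m := (bestSet ((A.outputUnion q o₁ o₂ m).powerset.filter fun X => o₁ X ∧ o₂ X)
    fun x => if x ∈ A.outputUnion q o₁ o₂ m then storedWeight (decode m) x else 0) ∩
      A.outputUnion q o₁ o₂ m
  step_elem j o₁ o₂ m x e d h := by
    split_ifs at h with hc
    · exact hc e d h
    · simp at h
  output_elem o₁ o₂ m e he := (mem_filter.1 (mem_inter.1 he).2).2

/-- The tagged cells `τ` represent the memories `m a` of the runs. -/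
structure Represents (I : MatroidStream ℝ) (q : ℕ) (τ : List TaggedCell)
    (m : ℤ → List (Cell Unit)) : Prop where
  mem_order : ∀ t ∈ τ, t.e ∈ I.order
  data_eq : ∀ t ∈ τ, t.d = I.data t.e
  window_mem : ∀ t ∈ τ, t.window q ∈ windowsOf q t.d
  runMem_eq : ∀ a, runMem q a τ = m a
  stored : ∀ a, ∀ x ∈ storedElems (m a), x ∈ (I.windowInstance q a).order

variable {A q} {I : MatroidStream ℝ} {τ : List TaggedCell} {m : ℤ → List (Cell Unit)}

theorem Represents.storedWeight_eq (h : Represents I q τ m) {x : ℕ}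
    (hx : x ∈ storedElems (encode τ)) : storedWeight τ x = I.data x := by
  obtain ⟨t, ht, rfl, hd⟩ := storedWeight_spec (mem_storedElems_encode.1 hx)
  rw [← hd, h.data_eq t ht]

theorem Represents.availWeight_eq (h : Represents I q τ m) {e x : ℕ}
    (hx : x ∈ insert e (storedElems (encode τ))) : availWeight τ e (I.data e) x = I.data x := by
  unfold availWeight
  split_ifs with hxe
  · rw [hxe]
  · exact h.storedWeight_eq (hx.resolve_left hxe)

theorem copyBase_mem_of_mem_runMem {a : ℤ} {x : ℕ} (hx : x ∈ storedElems (runMem q a τ)) :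
    copyBase x ∈ storedElems (encode τ) := by
  obtain ⟨d, hd⟩ := hx
  simp only [runMem, List.mem_map, List.mem_filter] at hd
  obtain ⟨t, ⟨ht, -⟩, htc⟩ := hd
  refine mem_storedElems_encode.2 ⟨t, ht, ?_⟩
  unfold toCell at htc
  split_ifs at htc
  cases htc
  simp [copyBase]

/-- A simulated run is the run on the unfolded window instance. -/
theorem Represents.runStep_eq (h : Represents I q τ m) (j : ℕ) {e : ℕ} (he : e ∈ I.order) (a : ℤ) :
    A.runStep q j (localOracle I.M₁ (insert e (storedElems (encode τ))))
        (localOracle I.M₂ (insert e (storedElems (encode τ)))) τ e (I.data e) a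
      = (MatroidStream.copies (windowMult q a (I.data e)) e).foldl
          (A.readElem (I.windowInstance q a) j) (m a) ∧
    ∀ x ∈ storedElems ((MatroidStream.copies (windowMult q a (I.data e)) e).foldl
      (A.readElem (I.windowInstance q a) j) (m a)), x ∈ (I.windowInstance q a).order ∧
        copyBase x ∈ insert e (storedElems (encode τ)) := by
  set s : Set ℕ := {x | x ∈ (I.windowInstance q a).order ∧
    copyBase x ∈ insert e (storedElems (encode τ))} with hs
  have hcop : ∀ x ∈ MatroidStream.copies (windowMult q a (I.data e)) e, x ∈ s := fun x hx => by
    have hx' := MatroidStream.mem_copies.1 hx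
    refine ⟨MatroidStream.mem_unfoldList.2 ?_, Or.inl hx'.1⟩
    rw [hx'.1]
    exact ⟨he, hx'.2⟩
  have hm : storedElems (m a) ⊆ s := fun x hx =>
    ⟨h.stored a x hx, Or.inr (copyBase_mem_of_mem_runMem (by rwa [h.runMem_eq a]))⟩
  refine ⟨?_, A.storedElems_foldl _ j _ _ hm hcop⟩
  unfold runStep
  rw [h.runMem_eq a]
  generalize m a = m₀ at hm
  generalize MatroidStream.copies (windowMult q a (I.data e)) e = l at hcop
  induction l generalizing m₀ with
  | nil => rfl
  | cons x l ih =>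
    -- Every copy at hand belongs to the window instance and has an available base of known weight,
    -- so the simulated oracles and keys agree with the true ones.
    have hxs : insert x (storedElems m₀) ⊆ s :=
      Set.insert_subset (hcop x List.mem_cons_self) hm
    have h1 : A.step j
        (unfoldOracle MatroidStream.primalKey
          (localOracle I.M₁ (insert e (storedElems (encode τ)))) (insert x (storedElems m₀)))
        (unfoldOracle
          (MatroidStream.dualKey fun y => windowMult q a (availWeight τ e (I.data e) y))
          (localOracle I.M₂ (insert e (storedElems (encode τ)))) (insert x (storedElems m₀)))
        m₀ (x, ()) = A.readElem (I.windowInstance q a) j m₀ x := by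
      rw [readElem, ← localOracle_unfoldMatroid (κ := MatroidStream.primalKey)
        (E := {x | x ∈ (I.windowInstance q a).order}) (fun y hy => (hxs hy).1)
        (fun y hy => (hxs hy).2) (fun _ _ => rfl),
        ← localOracle_unfoldMatroid
          (κ := MatroidStream.dualKey fun y => windowMult q a (I.data y))
        (E := {x | x ∈ (I.windowInstance q a).order}) (fun y hy => (hxs hy).1)
        (fun y hy => (hxs hy).2) (fun y hy => by
          simp only [MatroidStream.dualKey]
          rw [h.availWeight_eq (hxs hy).2])]
      rfl
    rw [List.foldl_cons, List.foldl_cons, h1]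
    exact ih _ ((A.storedElems_readElem _ _ _ _).trans hxs)
      fun y hy => hcop y (List.mem_cons_of_mem _ hy)

theorem filter_flatMap_eq {β : Type*} (f : β → ℤ) (g : ℤ → List β) {a : ℤ} : ∀ {l : List ℤ},
    l.Nodup → (∀ b ∈ l, ∀ t ∈ g b, f t = b) →
    (l.flatMap g).filter (fun t => f t = a) = if a ∈ l then g a else []
  | [], _, _ => by simp
  | b :: l, hl, hg => by
    have ih := filter_flatMap_eq f g (a := a) (List.nodup_cons.1 hl).2
      fun c hc => hg c (List.mem_cons_of_mem _ hc)
    have hb := hg b List.mem_cons_self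
    rw [List.flatMap_cons, List.filter_append, ih]
    by_cases hab : a = b
    · subst hab
      rw [List.filter_eq_self.2 (by simpa using hb), if_neg (List.nodup_cons.1 hl).1]
      simp
    · rw [List.filter_eq_nil_iff.2 (by
        intro t ht
        simp [hb t ht, Ne.symm hab])]
      simp [hab]

theorem Represents.step (h : Represents I q τ m) (j : ℕ) {e : ℕ} (he : e ∈ I.order) :
    ∃ τ', (A.windowAlg q).readElem I j (encode τ) e = encode τ' ∧
      Represents I q τ' fun a => (MatroidStream.copies (windowMult q a (I.data e)) e).foldl
        (A.readElem (I.windowInstance q a) j) (m a) := by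
  set o₁ := localOracle I.M₁ (insert e (storedElems (encode τ))) with ho₁
  set o₂ := localOracle I.M₂ (insert e (storedElems (encode τ))) with ho₂
  have hrun := fun a => h.runStep_eq (A := A) j he a
  rw [← ho₁, ← ho₂] at hrun
  have hnew : ∀ a ∈ windowsOf q (I.data e), ∀ c ∈ A.runStep q j o₁ o₂ τ e (I.data e) a,
      (ofCell q a (availWeight τ e (I.data e)) e (I.data e) c).e ∈ insert e (storedElems (encode τ)) ∧
      (ofCell q a (availWeight τ e (I.data e)) e (I.data e) c).d
        = I.data (ofCell q a (availWeight τ e (I.data e)) e (I.data e) c).e ∧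
      a ∈ windowsOf q (ofCell q a (availWeight τ e (I.data e)) e (I.data e) c).d ∧
      (ofCell q a (availWeight τ e (I.data e)) e (I.data e) c).window q = a := by
    intro a ha c hc
    have hwin : ∀ d : ℝ, a ∈ windowsOf q d →
        Int.log q d - ((Int.log q d - a).toNat : ℤ) = a := fun d hd => by
      have := (mem_windowsOf.1 hd).1
      omega
    rcases c with ⟨x, u⟩ | k
    · obtain ⟨hx1, hx2⟩ := (hrun a).2 x (by rw [← (hrun a).1]; exact ⟨u, hc⟩)
      have hx3 : a ∈ windowsOf q (I.data (copyBase x)) := mem_windowsOf.2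
        (inWindow_of_windowMult_pos ((Nat.zero_le _).trans_lt
          (MatroidStream.mem_unfoldList.1 hx1).2))
      simp only [ofCell, window]
      rw [h.availWeight_eq hx2]
      exact ⟨hx2, rfl, hx3, hwin _ hx3⟩
    · exact ⟨Or.inl rfl, rfl, ha, hwin _ ha⟩
  have hmem : ∀ t ∈ A.windowStep q j o₁ o₂ τ e (I.data e), t ∈ τ ∨
      (t.e ∈ insert e (storedElems (encode τ)) ∧ t.d = I.data t.e ∧
        t.window q ∈ windowsOf q t.d) := by
    intro t ht
    simp only [windowStep, List.mem_append, List.mem_filter, List.mem_flatMap, List.mem_map,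
      mem_toList] at ht
    rcases ht with ht | ⟨a, ha, c, hc, rfl⟩
    · exact Or.inl ht.1
    · obtain ⟨h1, h2, h3, h4⟩ := hnew a ha c hc
      exact Or.inr ⟨h1, h2, by rwa [h4]⟩
  refine ⟨A.windowStep q j o₁ o₂ τ e (I.data e), ?_, ?_, ?_, ?_, ?_, ?_⟩
  · rw [readElem]
    simp only [windowAlg, decode_encode]
    rw [← ho₁, ← ho₂, if_pos]
    intro e' d' hed
    rw [decode_encode] at hed
    obtain ⟨t, ht, rfl, rfl⟩ := elem_mem_encode.1 hed
    rcases hmem t ht with ht | ⟨ht1, ht2, -⟩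
    · exact Or.inl (elem_mem_encode.2 ⟨t, ht, rfl, rfl⟩)
    · rcases ht1 with ht1 | ⟨d, hd⟩
      · right
        rw [ht2, ht1]
      · left
        obtain ⟨t', ht', hte, htd⟩ := elem_mem_encode.1 hd
        refine elem_mem_encode.2 ⟨t', ht', hte, ?_⟩
        rw [ht2, ← hte, h.data_eq t' ht']
  · intro t ht
    rcases hmem t ht with ht | ⟨ht1, -⟩
    · exact h.mem_order t ht
    · rcases ht1 with ht1 | ht1
      · rwa [ht1]
      · obtain ⟨t', ht', hte⟩ := mem_storedElems_encode.1 ht1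
        exact hte ▸ h.mem_order t' ht'
  · intro t ht
    rcases hmem t ht with ht | ⟨-, ht2, -⟩
    · exact h.data_eq t ht
    · exact ht2
  · intro t ht
    rcases hmem t ht with ht | ⟨-, -, ht3⟩
    · exact h.window_mem t ht
    · exact ht3
  · intro a
    rw [← (hrun a).1, runMem, windowStep, List.filter_append, filter_flatMap_eq (window q) _
      (nodup_toList _) (by
        intro b hb t ht
        obtain ⟨c, hc, rfl⟩ := List.mem_map.1 ht
        exact (hnew b (mem_toList.1 hb) c hc).2.2.2), List.filter_filter]
    by_cases ha : a ∈ windowsOf q (I.data e)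
    · rw [if_pos (mem_toList.2 ha), List.filter_eq_nil_iff.2 (by
        intro t _
        simp only [Bool.and_eq_true, decide_eq_true_eq, not_and]
        rintro rfl
        simpa using ha), List.nil_append, List.map_map]
      conv_rhs => rw [← List.map_id (A.runStep q j o₁ o₂ τ e (I.data e) a)]
      exact List.map_congr_left fun c _ => toCell_ofCell _ _ _ _ _ c
    -- Outside its window the element has no copies, so the run neither moves nor loses cells.
    · have hmult : windowMult q a (I.data e) = 0 := by
        rw [windowMult, if_neg fun h => ha (mem_windowsOf.2 h)]
      rw [if_neg (mt mem_toList.1 ha), List.append_nil, runStep, hmult]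
      refine congrArg (List.map toCell) (List.filter_congr fun t _ => ?_)
      by_cases hta : t.window q = a
      · simp [hta, ha]
      · simp [hta]
  · exact fun a x hx => ((hrun a).2 x hx).1

theorem Represents.foldl (j : ℕ) : ∀ {l : List ℕ} {τ : List TaggedCell}
    {m : ℤ → List (Cell Unit)}, Represents I q τ m → (∀ e ∈ l, e ∈ I.order) →
    ∃ τ', l.foldl ((A.windowAlg q).readElem I j) (encode τ) = encode τ' ∧
      Represents I q τ' fun a =>
        (MatroidStream.unfoldList (fun e => windowMult q a (I.data e)) l).foldl
          (A.readElem (I.windowInstance q a) j) (m a)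
  | [], τ, m, h, _ => ⟨τ, rfl, h⟩
  | e :: l, τ, m, h, hl => by
    obtain ⟨τ₁, h1, h2⟩ := h.step (A := A) j (hl e List.mem_cons_self)
    obtain ⟨τ₂, h3, h4⟩ := h2.foldl j (l := l) fun x hx => hl x (List.mem_cons_of_mem _ hx)
    refine ⟨τ₂, by rw [List.foldl_cons, h1, h3], ?_⟩
    simpa only [MatroidStream.unfoldList, List.flatMap_cons, List.foldl_append] using h4

theorem exists_represents_startMem (A : StreamAlg Unit) (q : ℕ) (I : MatroidStream ℝ) (j : ℕ) :
    ∃ τ, (A.windowAlg q).startMem I j = encode τ ∧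
      Represents I q τ fun a => A.startMem (I.windowInstance q a) j := by
  induction j with
  | zero =>
    refine ⟨[], rfl, by simp, by simp, by simp, fun a => rfl, ?_⟩
    simp [startMem, storedElems]
  | succ j ih =>
    obtain ⟨τ, h1, h2⟩ := ih
    obtain ⟨τ', h3, h4⟩ := h2.foldl (A := A) j (l := I.order) fun _ h => h
    exact ⟨τ', by rw [startMem, h1, h3], h4⟩

/-- A prefix of the stream unfolds to a prefix of each window stream, so every intermediate memory
consists of memories that occur in the individual runs. -/
theorem exists_represents_memAt (A : StreamAlg Unit) (q : ℕ) (I : MatroidStream ℝ) (j k : ℕ) :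
    ∃ τ, (A.windowAlg q).memAt I j k = encode τ ∧ ∃ m : ℤ → List (Cell Unit),
      Represents I q τ m ∧ ∀ a, ∃ k' ≤ (I.windowInstance q a).size,
        m a = A.memAt (I.windowInstance q a) j k' := by
  obtain ⟨τ, h1, h2⟩ := exists_represents_startMem A q I j
  obtain ⟨τ', h3, h4⟩ := h2.foldl (A := A) j (l := I.order.take k)
    fun _ h => List.mem_of_mem_take h
  refine ⟨τ', by rw [memAt, h1, h3], _, h4, fun a => ?_⟩
  have hsplit : (I.windowInstance q a).order
      = MatroidStream.unfoldList (fun e => windowMult q a (I.data e)) (I.order.take k)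
        ++ MatroidStream.unfoldList (fun e => windowMult q a (I.data e)) (I.order.drop k) := by
    rw [MatroidStream.unfoldList, MatroidStream.unfoldList, ← List.flatMap_append,
      List.take_append_drop]
    rfl
  refine ⟨(MatroidStream.unfoldList (fun e => windowMult q a (I.data e))
    (I.order.take k)).length, ?_, ?_⟩
  · rw [MatroidStream.size, hsplit, List.length_append]
    exact Nat.le_add_right _ _
  · rw [memAt, hsplit, List.take_left]

open Classical in
/-- The heaviest common independent set in `U`. -/
def bestCommonIndep (I : MatroidStream ℝ) (U : Finset ℕ) : Finset ℕ :=
  bestSet (U.powerset.filter fun X => I.CommonIndep X) (fun x => if x ∈ U then I.data x else 0)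

theorem bestCommonIndep_spec (I : MatroidStream ℝ) (U : Finset ℕ) :
    bestCommonIndep I U ⊆ U ∧ I.CommonIndep (bestCommonIndep I U) ∧
      ∀ X ⊆ U, I.CommonIndep X → I.weight X ≤ I.weight (bestCommonIndep I U) := by
  classical
  have hne : (U.powerset.filter fun X => I.CommonIndep X).Nonempty :=
    ⟨∅, by simp [I.commonIndep_empty]⟩
  have h := bestSet_spec hne (fun x => if x ∈ U then I.data x else 0)
  have hw : ∀ X ⊆ U, ∑ e ∈ X, (if e ∈ U then I.data e else 0) = I.weight X := fun X hX =>
    sum_congr rfl fun e he => if_pos (hX he)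
  obtain ⟨h1, h2⟩ := mem_filter.1 h.1
  rw [mem_powerset] at h1
  refine ⟨h1, h2, fun X hX hXi => ?_⟩
  have h3 := h.2 X (mem_filter.2 ⟨mem_powerset.2 hX, hXi⟩)
  rwa [hw X hX, hw _ h1] at h3

/-- The output depends on the runs only through the union of their projected results. This reduces
its measurability and its value to those of the runs. -/
theorem windowAlg_result (A : StreamAlg Unit) (q : ℕ) (I : MatroidStream ℝ) (p : ℕ) :
    (A.windowAlg q).result I p = bestCommonIndep I
      ((I.windows q).biUnion fun a => (A.result (I.windowInstance q a) p).image copyBase) := by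
  classical
  obtain ⟨τ, h1, h⟩ := exists_represents_startMem A q I p
  rw [result, h1]
  set o₁ := localOracle I.M₁ (storedElems (encode τ)) with ho₁
  set o₂ := localOracle I.M₂ (storedElems (encode τ)) with ho₂
  have hstored : ∀ a, ∀ x ∈ storedElems (runMem q a τ), x ∈ (I.windowInstance q a).order ∧
      copyBase x ∈ storedElems (encode τ) := fun a x hx =>
    ⟨h.stored a x (by rwa [← h.runMem_eq a]), copyBase_mem_of_mem_runMem hx⟩
  have hout : ∀ a, A.output
      (unfoldOracle MatroidStream.primalKey o₁ (storedElems (runMem q a τ)))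
      (unfoldOracle (MatroidStream.dualKey fun y => windowMult q a (storedWeight τ y)) o₂
        (storedElems (runMem q a τ))) (runMem q a τ) = A.result (I.windowInstance q a) p := by
    intro a
    rw [ho₁, ho₂, ← localOracle_unfoldMatroid (κ := MatroidStream.primalKey)
        (E := {x | x ∈ (I.windowInstance q a).order}) (fun y hy => (hstored a y hy).1)
        (fun y hy => (hstored a y hy).2) (fun _ _ => rfl),
      ← localOracle_unfoldMatroid
          (κ := MatroidStream.dualKey fun y => windowMult q a (I.data y))
        (E := {x | x ∈ (I.windowInstance q a).order}) (fun y hy => (hstored a y hy).1)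
        (fun y hy => (hstored a y hy).2) (fun y hy => by
          simp only [MatroidStream.dualKey]
          rw [h.storedWeight_eq (hstored a y hy).2])]
    rw [result, ← h.runMem_eq a]
    rfl
  have hres : ∀ a, ∀ x ∈ A.result (I.windowInstance q a) p,
      x ∈ storedElems (runMem q a τ) := fun a x hx => by
    rw [← hout a] at hx
    exact A.output_elem _ _ _ _ hx
  have hU : A.outputUnion q o₁ o₂ (encode τ) = (I.windows q).biUnion
      fun a => (A.result (I.windowInstance q a) p).image copyBase := by
    ext e
    simp only [outputUnion, decode_encode, hout, mem_filter, mem_biUnion, List.mem_toFinset,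
      List.mem_map, mem_image]
    constructor
    · rintro ⟨⟨_, ⟨t, ht, rfl⟩, x, hx, rfl⟩, -⟩
      refine ⟨_, mem_biUnion.2 ⟨t.e, List.mem_toFinset.2 (h.mem_order t ht), ?_⟩, x, hx, rfl⟩
      rw [← h.data_eq t ht]
      exact h.window_mem t ht
    · rintro ⟨a, -, x, hx, rfl⟩
      have hx' := hres a x hx
      refine ⟨⟨a, ?_, x, hx, rfl⟩, (hstored a x hx').2⟩
      obtain ⟨d, hd⟩ := hx'
      simp only [runMem, List.mem_map, List.mem_filter, decide_eq_true_eq] at hd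
      obtain ⟨t, ⟨ht, hta⟩, -⟩ := hd
      exact ⟨t, ht, hta⟩
  have hUs : ∀ x ∈ A.outputUnion q o₁ o₂ (encode τ), x ∈ storedElems (encode τ) :=
    fun x hx => (mem_filter.1 hx).2
  -- Since `bestSet` is an arbitrary choice among maximizers, the families and the weight functions
  -- must agree exactly.
  have key : bestSet ((A.outputUnion q o₁ o₂ (encode τ)).powerset.filter fun X => o₁ X ∧ o₂ X)
      (fun x => if x ∈ A.outputUnion q o₁ o₂ (encode τ) then storedWeight τ x else 0)
      = bestCommonIndep I (A.outputUnion q o₁ o₂ (encode τ)) := by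
    unfold bestCommonIndep
    congr 1
    · refine filter_congr fun X hX => ?_
      have hXs : (X : Set ℕ) ⊆ storedElems (encode τ) := fun x hx =>
        hUs x (mem_powerset.1 hX hx)
      simp only [ho₁, ho₂, localOracle, hXs, true_and]
      rfl
    · funext x
      split_ifs with hx
      · exact h.storedWeight_eq (hUs x hx)
      · rfl
  simp only [windowAlg, decode_encode]
  rw [key, hU, inter_eq_left]
  exact (bestCommonIndep_spec I _).1

end StreamAlg

end WindowAlgorithm

/-! ### Space, word range, number of windows and expected value. -/

section WindowAnalysis

open Finset TaggedCell

namespace StreamAlg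

variable {A : StreamAlg Unit} {q γ p : ℕ} {I : MatroidStream ℝ}

theorem params_windowInstance_le (hγ : q ^ q ≤ γ) (a : ℤ) :
    (I.windowInstance q a).params ≤ scaleParams γ I.params :=
  MatroidStream.params_unfold_le fun _ _ => windowMult_le.trans hγ

theorem spaceAtMost_windowAlg {S : ℕ × ℕ × ℕ × ℕ → ℝ} (hγ : q ^ q ≤ γ) (hS : Monotone S)
    (h : ∀ I' : MatroidStream Unit, A.SpaceAtMost I' p (S I'.params)) :
    (A.windowAlg q).SpaceAtMost I p (3 * (#(I.windows q) * S (scaleParams γ I.params))) := by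
  intro j hj k _
  obtain ⟨τ, h1, m, hr, hm⟩ := exists_represents_memAt A q I j k
  rw [h1, length_encode, length_eq_sum_runMem (q := q) (s := I.windows q) fun t ht =>
    mem_biUnion.2 ⟨t.e, List.mem_toFinset.2 (hr.mem_order t ht),
      hr.data_eq t ht ▸ hr.window_mem t ht⟩]
  push_cast
  gcongr
  rw [← nsmul_eq_mul]
  refine sum_le_card_nsmul _ _ _ fun a _ => ?_
  obtain ⟨k', hk', hk''⟩ := hm a
  rw [hr.runMem_eq, hk'']
  exact (h _ j hj k' hk').trans (hS (params_windowInstance_le hγ a))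

theorem wordsBelow_windowAlg {b : ℕ → ℕ} (hγ : q ^ q ≤ γ) (hb : Monotone b)
    (h : ∀ I' : MatroidStream Unit, A.WordsBelow I' p (b I'.size)) :
    (A.windowAlg q).WordsBelow I p (2 * ((γ : ℝ) + b (γ * I.size))) := by
  intro j hj k _ v hv
  obtain ⟨τ, h1, m, hr, hm⟩ := exists_represents_memAt A q I j k
  rw [h1, word_mem_encode] at hv
  obtain ⟨t, ht, hv⟩ := hv
  have hwin := _root_.mem_windowsOf.1 (hr.window_mem t ht)
  suffices v < 2 * (γ + b (γ * I.size)) by exact_mod_cast this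
  rcases hv with rfl | rfl
  -- The shift is less than `q`, and `q ≤ q ^ q ≤ γ`.
  · have h2 := hwin.2
    have h3 := hwin.two_le
    have h4 : q ≤ q ^ q := Nat.le_self_pow (by omega) q
    simp only [window] at h2
    omega
  · have hmem : t.toCell ∈ m (t.window q) := by
      rw [← hr.runMem_eq, runMem]
      exact List.mem_map_of_mem (List.mem_filter.2 ⟨ht, by simp⟩)
    by_cases hpar : t.code % 2 = 0
    · rw [toCell, if_pos hpar] at hmem
      have h2 := (MatroidStream.mem_unfoldList.1 (hr.stored _ _ ⟨_, hmem⟩)).2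
      rw [Nat.unpair_pair] at h2
      have h3 := (h2.trans_le windowMult_le).trans_le hγ
      omega
    · rw [toCell, if_neg hpar] at hmem
      obtain ⟨k', hk', hk''⟩ := hm (t.window q)
      rw [hk''] at hmem
      have h2 : t.code / 2 < b (I.windowInstance q (t.window q)).size := by
        exact_mod_cast h _ j hj k' hk' _ hmem
      have h3 := hb (params_windowInstance_le hγ (t.window q) (I := I)).1
      have h4 : t.code / 2 < b (γ * I.size) := h2.trans_le h3
      omega

end StreamAlg

namespace MatroidStream

variable {I : MatroidStream ℝ}

/-- The number of windows is logarithmic in the weight ratio. -/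
theorem card_windows_le {q : ℕ} (hq : 3 ≤ q) (hI : I.PositiveWeights) :
    0 ≤ Real.log I.weightRatio ∧ (#(I.windows q) : ℝ) ≤ Real.log I.weightRatio + q := by
  set s : Set ℝ := I.data '' {e | e ∈ I.order} with hs
  have hfin : s.Finite := I.order.finite_toSet.image _
  rcases s.eq_empty_or_nonempty with hemp | hne
  · have h1 : I.order = [] := by
      rw [hs, Set.image_eq_empty] at hemp
      exact List.eq_nil_iff_forall_not_mem.2 fun e he => Set.eq_empty_iff_forall_notMem.1 hemp e he
    have h2 : I.windows q = ∅ := by simp [windows, h1]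
    rw [weightRatio, ← hs, hemp, h2]
    simp
  have hmax := hne.csSup_mem hfin
  have hmin := hne.csInf_mem hfin
  have hlemax : ∀ x ∈ s, x ≤ sSup s := fun x hx => le_csSup hfin.bddAbove hx
  have hlemin : ∀ x ∈ s, sInf s ≤ x := fun x hx => csInf_le hfin.bddBelow hx
  have hpos : ∀ x ∈ s, 0 < x := by
    rintro _ ⟨e, he, rfl⟩
    exact hI e he
  rw [weightRatio, ← hs]
  set w₁ := sSup s
  set w₀ := sInf s
  have hw₀ := hpos _ hmin
  have hw₁ := hpos _ hmax
  have hlog : 0 ≤ Real.log (w₁ / w₀) :=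
    Real.log_nonneg ((one_le_div hw₀).2 (hlemin _ hmax))
  refine ⟨hlog, ?_⟩
  have hsub : I.windows q ⊆ Ioo (Int.log q w₀ - q) (Int.log q w₁) := by
    intro a ha
    obtain ⟨e, he, ha⟩ := mem_biUnion.1 ha
    have hes : I.data e ∈ s := ⟨e, List.mem_toFinset.1 he, rfl⟩
    have h1 := Int.log_mono_right (b := q) hw₀ (hlemin _ hes)
    have h2 := Int.log_mono_right (b := q) (hpos _ hes) (hlemax _ hes)
    simp only [windowsOf, mem_Ioo] at ha ⊢
    omega
  have hcard := card_le_card hsub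
  rw [Int.card_Ioo] at hcard
  have hmono := Int.log_mono_right (b := q) hw₀ (hlemin _ hmax)
  have hcard' : (#(I.windows q) : ℤ) ≤ Int.log q w₁ - Int.log q w₀ - 1 + q := by omega
  have hcard'' : (#(I.windows q) : ℝ) ≤ ((Int.log q w₁ - Int.log q w₀ - 1 : ℤ) : ℝ) + q := by
    exact_mod_cast hcard'
  refine hcard''.trans (add_le_add_left ?_ _)
  set z := Int.log q w₁ - Int.log q w₀ - 1 with hz
  have hq1 : (1 : ℝ) < q := by norm_cast; omega
  have hq0 : (0 : ℝ) < q := by linarith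
  have hlogq : 1 ≤ Real.log q := by
    rw [Real.le_log_iff_exp_le hq0]
    have : (3 : ℝ) ≤ q := by exact_mod_cast hq
    linarith [Real.exp_one_lt_d9]
  -- The `-1` in `z` compensates for rounding: `w₀ < q ^ (log w₀ + 1)` while `q ^ (log w₁) ≤ w₁`. As
  -- `log q ≥ 1` for `q ≥ 3`, this gives `z ≤ log W`.
  have hzpow : (q : ℝ) ^ z ≤ w₁ / w₀ := by
    rw [le_div_iff₀ hw₀]
    have h1 := Int.lt_zpow_succ_log_self (b := q) (by omega) w₀
    have h2 := Int.zpow_log_le_self (b := q) (by omega) hw₁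
    calc (q : ℝ) ^ z * w₀ ≤ (q : ℝ) ^ z * (q : ℝ) ^ (Int.log q w₀ + 1) := by gcongr
      _ = (q : ℝ) ^ Int.log q w₁ := by
          rw [← zpow_add₀ hq0.ne']
          congr 1
          omega
      _ ≤ w₁ := h2
  have hlz : (z : ℝ) * Real.log q ≤ Real.log (w₁ / w₀) := by
    rw [← Real.log_zpow]
    exact Real.log_le_log (zpow_pos hq0 z) hzpow
  rcases le_or_gt 0 z with h | h
  · have : (0 : ℝ) ≤ z := by exact_mod_cast h
    nlinarith
  · have : (z : ℝ) < 0 := by exact_mod_cast h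
    linarith

end MatroidStream

variable {Ω : Type} [MeasurableSpace Ω]

theorem measurableSet_biUnion_image_eq {ι : Type*} {f : Ω → ι → Finset ℕ} (g : ℕ → ℕ)
    (hf : ∀ a X, MeasurableSet {ω | f ω a = X}) (R : Finset ι) (X : Finset ℕ) :
    MeasurableSet {ω | (R.biUnion fun a => (f ω a).image g) = X} := by
  classical
  let _ : MeasurableSpace (Finset ℕ) := ⊤
  have hm : Measurable fun ω => R.biUnion fun a => (f ω a).image g := by
    induction R using Finset.induction_on with
    | empty => simp
    | insert a R _ ih =>
      have h1 : Measurable fun ω => f ω a := measurable_to_countable' fun X => hf a X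
      have h2 : Measurable fun x : Finset ℕ × Finset ℕ => x.1.image g ∪ x.2 :=
        measurable_from_prod_countable_left fun _ => measurable_from_top
      simp only [biUnion_insert]
      exact h2.comp (h1.prodMk ih)
  exact hm (measurableSet_singleton X)

theorem integrable_comp_finset {P : Measure Ω} [IsFiniteMeasure P] {f : Ω → Finset ℕ}
    (hf : ∀ X, MeasurableSet {ω | f ω = X}) (g : Finset ℕ → ℝ) {B : ℝ} (hB : ∀ ω, |g (f ω)| ≤ B) :
    Integrable (fun ω => g (f ω)) P := by
  let _ : MeasurableSpace (Finset ℕ) := ⊤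
  have h1 : Measurable f := measurable_to_countable' hf
  have h2 : Measurable fun ω => g (f ω) := measurable_from_top.comp h1
  exact Integrable.of_bound h2.aestronglyMeasurable B
    (Filter.Eventually.of_forall fun ω => by simpa using hB ω)

variable {P : Measure Ω} {A : Ω → StreamAlg Unit} {p : ℕ} {α : ℝ}

theorem measurableSet_windowAlg_result (hA : IsUnweightedApprox P A p α) (q : ℕ)
    (I : MatroidStream ℝ) (X : Finset ℕ) :
    MeasurableSet {ω | ((A ω).windowAlg q).result I p = X} := by
  simp only [StreamAlg.windowAlg_result]
  have h := measurableSet_biUnion_image_eq copyBase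
    (f := fun ω a => (A ω).result (I.windowInstance q a) p) (fun a X => (hA _).1 X) (I.windows q)
  have : {ω | StreamAlg.bestCommonIndep I ((I.windows q).biUnion
      fun a => ((A ω).result (I.windowInstance q a) p).image copyBase) = X}
      = ⋃ U ∈ {U | StreamAlg.bestCommonIndep I U = X}, {ω | ((I.windows q).biUnion
      fun a => ((A ω).result (I.windowInstance q a) p).image copyBase) = U} := by
    ext ω
    simp
  rw [this]
  exact MeasurableSet.biUnion (Set.to_countable _) fun U _ => h U

theorem commonIndep_windowAlg_result (A : StreamAlg Unit) (q : ℕ) (I : MatroidStream ℝ) (p : ℕ) :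
    I.CommonIndep ((A.windowAlg q).result I p) := by
  rw [StreamAlg.windowAlg_result]
  exact (StreamAlg.bestCommonIndep_spec I _).2.1

theorem MatroidStream.weight_nonneg {I : MatroidStream ℝ} (hI : I.PositiveWeights) {J : Finset ℕ}
    (hJ : I.CommonIndep J) : 0 ≤ I.weight J :=
  sum_nonneg fun e he => (hI e (hJ.subset_order he)).le

/-- The merging bound holds for every outcome and is linear in the sizes of the window solutions, so
the guarantees of the separate runs combine by linearity of expectation, without independence. -/
theorem approx_windowAlg [IsProbabilityMeasure P] (hA : IsUnweightedApprox P A p α) (hα : 0 < α)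
    {q : ℕ} (hq : 2 ≤ q) {I : MatroidStream ℝ} (hI : I.PositiveWeights) {J : Finset ℕ}
    (hJ : I.CommonIndep J) :
    α * ((1 - 1 / q) ^ 2 * I.weight J)
      ≤ (1 + 4 / q) * ∫ ω, I.weight (((A ω).windowAlg q).result I p) ∂P := by
  have hq0 : (0 : ℝ) < q := by norm_cast; omega
  have hq1 : (0 : ℝ) ≤ 1 - 1 / q := by
    rw [sub_nonneg, div_le_one hq0]
    norm_cast
    omega
  have hJo : ∀ e ∈ J, e ∈ I.order := fun e he => hJ.subset_order he
  -- The residue class depends on `J` only, not on the random outcome.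
  obtain ⟨s, hs⟩ := MatroidStream.exists_residue hq hJo
  set R := (I.windows q).filter (fun a => a % q = s)
  set Jw : ℤ → Finset ℕ := fun a => J.filter fun e => a ∈ windowsOf q (I.data e) with hJw
  have hint : ∀ a, Integrable
      (fun ω => (#((A ω).result (I.windowInstance q a) p) : ℝ)) P := fun a =>
    integrable_comp_finset (hA _).1 (fun X => (#X : ℝ)) (B := (I.windowInstance q a).size)
      fun ω => by
        rw [abs_of_nonneg (Nat.cast_nonneg _)]
        exact_mod_cast MatroidStream.card_le_size ((hA _).2.1 ω)
  have hint' : Integrable (fun ω => I.weight (((A ω).windowAlg q).result I p)) P :=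
    integrable_comp_finset (measurableSet_windowAlg_result hA q I) I.weight
      (B := ∑ e ∈ I.order.toFinset, I.data e) fun ω => by
        have hc := commonIndep_windowAlg_result (A ω) q I p
        rw [abs_of_nonneg (MatroidStream.weight_nonneg hI hc)]
        exact sum_le_sum_of_subset_of_nonneg (fun e he => List.mem_toFinset.2 (hc.subset_order he))
          fun e he _ => (hI e (List.mem_toFinset.1 he)).le
  have hpt : ∀ ω, ∑ a ∈ R, (q : ℝ) ^ a * #((A ω).result (I.windowInstance q a) p)
      ≤ (1 + 4 / q) * I.weight (((A ω).windowAlg q).result I p) := fun ω => by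
    obtain ⟨T, hTU, hT, hTw⟩ := MatroidStream.exists_combined hq hI
      (fun a => (A ω).result (I.windowInstance q a) p) (I.windows q) s
      fun a _ => (hA (I.windowInstance q a)).2.1 ω
    refine hTw.trans ?_
    rw [StreamAlg.windowAlg_result]
    gcongr
    exact (StreamAlg.bestCommonIndep_spec I _).2.2 T hTU hT
  calc α * ((1 - 1 / q) ^ 2 * I.weight J)
      = α * ((1 - 1 / q) * ((1 - 1 / q) * I.weight J)) := by ring
    _ ≤ α * ((1 - 1 / q) * ∑ a ∈ R, I.weight (Jw a)) := by gcongr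
    _ = ∑ a ∈ R, α * ((1 - 1 / q) * I.weight (Jw a)) := by rw [mul_sum, mul_sum]
    _ ≤ ∑ a ∈ R, (q : ℝ) ^ a * ∫ ω, (#((A ω).result (I.windowInstance q a) p) : ℝ) ∂P := by
        refine sum_le_sum fun a _ => ?_
        have h1 := MatroidStream.weight_window_le hq hI hJo a
        have h2 := (hA (I.windowInstance q a)).2.2 _
          ((hJ.mono (filter_subset _ _) : I.CommonIndep (Jw a)).unfold
            (μ := fun e => windowMult q a (I.data e)))
        calc α * ((1 - 1 / q) * I.weight (Jw a))
            ≤ α * ((q : ℝ) ^ a * #(MatroidStream.unfoldSet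
                (fun e => windowMult q a (I.data e)) (Jw a))) := by gcongr
          _ = (q : ℝ) ^ a * (α * #(MatroidStream.unfoldSet
                (fun e => windowMult q a (I.data e)) (Jw a))) := by ring
          _ ≤ _ := by gcongr
    _ = ∫ ω, ∑ a ∈ R, (q : ℝ) ^ a * #((A ω).result (I.windowInstance q a) p) ∂P := by
        rw [integral_finsetSum _ fun a _ => (hint a).const_mul _]
        simp only [integral_const_mul]
    _ ≤ ∫ ω, (1 + 4 / q) * I.weight (((A ω).windowAlg q).result I p) ∂P :=
        integral_mono (integrable_finsetSum _ fun a _ => (hint a).const_mul _)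
          (hint'.const_mul _) hpt
    _ = _ := integral_const_mul _ _

end WindowAnalysis

/-! ### Choice of the constants and conclusion. -/

/-- The base of the windows for the error parameter `ε`; there are no windows if `1 ≤ ε`. -/
def windowBase (ε : ℝ) : ℕ := if ε < 1 then ⌈6 / ε⌉₊ else 0

theorem windowBase_bounds {ε : ℝ} (h0 : 0 < ε) (h1 : ε < 1) :
    7 ≤ windowBase ε ∧ 6 / ε ≤ windowBase ε ∧ (windowBase ε : ℝ) ≤ 7 / ε := by
  rw [windowBase, if_pos h1]
  have h2 : 6 < 6 / ε := by rw [lt_div_iff₀ h0]; linarith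
  refine ⟨Nat.lt_ceil.2 (by exact_mod_cast h2), Nat.le_ceil _, ?_⟩
  have h3 := Nat.ceil_lt_add_one (show 0 ≤ 6 / ε by positivity)
  have h4 : 7 / ε = 6 / ε + 1 / ε := by ring
  have h5 : 1 ≤ 1 / ε := by rw [le_div_iff₀ h0]; linarith
  linarith

theorem windowBase_pow_le {ε : ℝ} (h0 : 0 < ε) :
    windowBase ε ^ windowBase ε ≤ gammaEps (ε / 7) := by
  have hx : 1 / (ε / 7) = 7 / ε := by field_simp
  rw [gammaEps, hx]
  by_cases h1 : ε < 1
  · obtain ⟨h2, -, h3⟩ := windowBase_bounds h0 h1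
    have h4 : (1 : ℝ) ≤ windowBase ε := by norm_cast; omega
    have h5 : ((windowBase ε ^ windowBase ε : ℕ) : ℝ) ≤ (7 / ε) ^ (7 / ε) := by
      push_cast
      rw [← Real.rpow_natCast]
      exact (Real.rpow_le_rpow (by linarith) h3 (by linarith)).trans
        (Real.rpow_le_rpow_of_exponent_le (by linarith) h3)
    exact_mod_cast h5.trans (Nat.le_ceil _)
  -- Here the base is `0`, and `0 ^ 0 = 1` still has to be at most `γ`.
  · rw [windowBase, if_neg h1, pow_zero]
    exact Nat.one_le_iff_ne_zero.2 (Nat.ceil_pos.2 (by positivity)).ne'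

theorem card_windows_windowBase_le {ε : ℝ} (h0 : 0 < ε) {I : MatroidStream ℝ}
    (hI : I.PositiveWeights) :
    ((I.windows (windowBase ε)).card : ℝ) ≤ 7 * ((1 + Real.log I.weightRatio) / ε) := by
  have hlog := (MatroidStream.card_windows_le le_rfl hI).1
  by_cases h1 : ε < 1
  · obtain ⟨h2, -, h3⟩ := windowBase_bounds h0 h1
    have h4 := (MatroidStream.card_windows_le (show 3 ≤ windowBase ε by omega) hI).2
    have h5 : 1 ≤ 7 / ε := by rw [le_div_iff₀ h0]; linarith
    have h6 : 7 * ((1 + Real.log I.weightRatio) / ε) = 7 / ε + 7 / ε * Real.log I.weightRatio := by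
      ring
    nlinarith
  · have h2 : I.windows (windowBase ε) = ∅ := by
      ext a
      simp [MatroidStream.windows, windowBase, h1, windowsOf]
    rw [h2]
    simp only [Finset.card_empty, Nat.cast_zero]
    positivity

end

theorem mainTheorem4 :
    ∃ c C : ℝ, 1 ≤ c ∧ 0 < C ∧
      ∀ (ε : ℝ), 0 < ε → ∀ (α : ℝ), 0 < α → α ≤ 1 →
      ∀ (p : ℕ) (S : ℕ × ℕ × ℕ × ℕ → ℝ), Monotone S → ∀ (b : ℕ → ℕ), Monotone b →
      ∀ (Ω : Type) [MeasurableSpace Ω] (P : Measure Ω) [IsProbabilityMeasure P]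
        (Au : Ω → StreamAlg Unit),
        IsUnweightedApprox P Au p α →
        (∀ ω, ∀ I : MatroidStream Unit, (Au ω).SpaceAtMost I p (S I.params)) →
        (∀ ω, ∀ I : MatroidStream Unit, (Au ω).WordsBelow I p (b I.size)) →
        ∃ Aw : Ω → StreamAlg ℝ,
          IsWeightedApprox P Aw p (α * (1 - ε)) ∧
          (∀ ω, ∀ I : MatroidStream ℝ, I.PositiveWeights →
            (Aw ω).SpaceAtMost I p
              (C * (S (scaleParams (gammaEps (ε / c)) I.params)
                * (1 + Real.log I.weightRatio) / ε))) ∧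
          (∀ ω, ∀ I : MatroidStream ℝ, I.PositiveWeights →
            (Aw ω).WordsBelow I p
              (C * ((gammaEps (ε / c) : ℝ) + (b (gammaEps (ε / c) * I.size) : ℝ)))) ∧
          ((∀ ω ω', Au ω = Au ω') → ∀ ω ω', Aw ω = Aw ω') := by
  -- `c = 7` comes from `q ≤ 7 / ε`. `C = 21` is three cells per simulated cell times at most `7 (1
  -- + log W) / ε` windows, and exceeds the factor `2` for words.
  refine ⟨7, 21, by norm_num, by norm_num, ?_⟩
  intro ε hε α hα _ p S hS b hb Ω _ P _ Au hA hspace hwords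
  have hγ := windowBase_pow_le hε
  refine ⟨fun ω => (Au ω).windowAlg (windowBase ε), fun I hI =>
    ⟨measurableSet_windowAlg_result hA _ I, fun ω => commonIndep_windowAlg_result _ _ _ _,
      fun J hJ => ?_⟩, fun ω I hI j hj k hk => ?_, fun ω I hI j hj k hk v hv => ?_,
    fun h ω ω' => congrArg (fun A => StreamAlg.windowAlg A (windowBase ε)) (h ω ω')⟩
  · have hJw := MatroidStream.weight_nonneg hI hJ
    by_cases h1 : ε < 1
    · obtain ⟨h2, h3, -⟩ := windowBase_bounds hε h1
      have h4 := approx_windowAlg hA hα (show 2 ≤ windowBase ε by omega) hI hJ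
      set q := windowBase ε
      have hq0 : (0 : ℝ) < q := by norm_cast; omega
      have h5 : 0 < 1 + 4 / (q : ℝ) := by positivity
      refine le_of_mul_le_mul_left (le_trans ?_ h4) h5
      have h6 : 6 / (q : ℝ) ≤ ε := by
        rw [div_le_iff₀ hε] at h3
        rw [div_le_iff₀ hq0]
        linarith
      -- With `x = 1 / q`, the `6` in `windowBase` matches `(1 + 4x)(1 - 6x) = 1 - 2x - 24x² ≤ (1 -
      -- x)²`.
      have h7 : (1 + 4 / (q : ℝ)) * (1 - ε) ≤ (1 - 1 / (q : ℝ)) ^ 2 := by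
        have h8 : (1 + 4 / (q : ℝ)) * (1 - ε) ≤ (1 + 4 / q) * (1 - 6 / q) := by gcongr
        refine h8.trans ?_
        have h9 : 0 ≤ 1 / (q : ℝ) := by positivity
        have h10 : 4 / (q : ℝ) = 4 * (1 / q) := by ring
        have h11 : 6 / (q : ℝ) = 6 * (1 / q) := by ring
        rw [h10, h11]
        nlinarith
      calc (1 + 4 / (q : ℝ)) * (α * (1 - ε) * I.weight J)
          = α * ((1 + 4 / (q : ℝ)) * (1 - ε) * I.weight J) := by ring
        _ ≤ α * ((1 - 1 / (q : ℝ)) ^ 2 * I.weight J) := by gcongr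
    · refine le_trans (mul_nonpos_of_nonpos_of_nonneg
        (mul_nonpos_of_nonneg_of_nonpos hα.le (by linarith)) hJw) ?_
      exact integral_nonneg fun ω =>
        MatroidStream.weight_nonneg hI (commonIndep_windowAlg_result _ _ _ _)
  · refine (StreamAlg.spaceAtMost_windowAlg hγ hS (hspace ω) j hj k hk).trans ?_
    -- `S` is real-valued; it is nonnegative here because it bounds an actual memory length.
    have hS0 : 0 ≤ S (scaleParams (gammaEps (ε / 7)) I.params) :=
      (Nat.cast_nonneg _).trans ((hspace ω (I.windowInstance (windowBase ε) 0) j hj 0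
        (Nat.zero_le _)).trans (hS (StreamAlg.params_windowInstance_le hγ 0)))
    have h1 := mul_le_mul_of_nonneg_right (card_windows_windowBase_le hε hI) hS0
    calc _ ≤ 3 * (7 * ((1 + Real.log I.weightRatio) / ε)
            * S (scaleParams (gammaEps (ε / 7)) I.params)) := by gcongr
      _ = _ := by ring
  · refine (StreamAlg.wordsBelow_windowAlg hγ hb (hwords ω) j hj k hk v hv).trans_le ?_
    gcongr
    norm_num
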